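/- **Definitions.** A quantum Markov chain (QMC) $\mathcal G=(\mathcal H,\mathcal E,\rho_0)$ of dimension $d$ consists of $\mathcal H=\mathbb C^d$, a super-operator $\mathcal E$, i.e. a linear map on $d\times d$ complex matrices of the form $\mathcal E(\rho)=\sum_{k<m}E_k\rho E_k^\dagger$ with $m\le d^2$ and $\sum_k E_k^\dagger E_k=I$ (the $E_k$ are called Kraus operators of $\mathcal E$), and an initial state $\rho_0$, i.e. a positive semidefinite matrix with trace $1$. It is *periodically stable* if there is an integer $\theta>0$ such that $\lim_{n\to\infty}\mathcal E^{n\theta}(\rho_0)$ exists (and is a quantum state); the least such $\theta$ is the *period* $p(\mathcal G)$. **Model of computation.** Programs are while-programs on a random access machine with a natural-number memory and a complex memory addressed by natural numbers. The following are elementary operations: constants, copying through indirect addresses, $+$, truncated $-$, $\times$, integer division, $\gcd$ and the tests $<$, $=$ on natural numbers; the constant $1$, $+,-,\times,/$, conjugation and the test $=$ on complex numbers, all exact; finding some complex root of a non-constant polynomial whose $k+1$ coefficients are stored in consecutive cells; and the symbolic test that, for a complex number $z$, returns the least $q\ge1$ with $z^q=1$, or $0$ if $z$ is not a root of unity. Root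 finding costs $k+1$, every other operation costs $1$. The input is $d$, $m$, the entries of $E_0,\dots,E_{m-1}$ (with $m\le d^2$) and the entries of $\rho_0$. **Proposition.** 1. There are a program and a constant $C$ such that, for every $d$ and every $d$-dimensional QMC $\mathcal G$, given by any family of at most $d^2$ Kraus operators and by $\rho_0$, the program halts after time at most $C\,d^8$ and decides whether $\mathcal G$ is periodically stable. 2. There are a program and a constant $C$ such that, for every $d$ and every periodically stable $d$-dimensional QMC $\mathcal G$, given in the same way, the program halts after time at most $C\,d^8$ and outputs the period $p(\mathcal G)$. -/

import Mathlib

open Filter Topology Matrix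
open scoped ComplexOrder

namespace QMC

/-! ## Quantum Markov chains -/

/-- Quantum (mixed) states on a `d`-dimensional Hilbert space, written in the computational basis:
positive semidefinite (in particular Hermitian) matrices of trace one. -/
def IsState {d : ℕ} (ρ : Matrix (Fin d) (Fin d) ℂ) : Prop :=
  ρ.PosSemidef ∧ ρ.trace = 1

/-- `K₀, …, K_{m-1}` are Kraus operators of the linear map `T` on `d × d` matrices:
`T ρ = ∑ₖ Kₖ ρ Kₖ†`, with the trace-preserving condition `∑ₖ Kₖ† Kₖ = I`. -/
def IsKraus {d m : ℕ} (T : Matrix (Fin d) (Fin d) ℂ →ₗ[ℂ] Matrix (Fin d) (Fin d) ℂ)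
    (K : Fin m → Matrix (Fin d) (Fin d) ℂ) : Prop :=
  (∀ ρ, T ρ = ∑ k, K k * ρ * (K k)ᴴ) ∧ ∑ k, (K k)ᴴ * K k = 1

/-- A quantum Markov chain on a `d`-dimensional Hilbert space: a super-operator (a linear map with
a Kraus representation by at most `d²` operators) and an initial state. -/
structure Chain (d : ℕ) where
  superOp : Matrix (Fin d) (Fin d) ℂ →ₗ[ℂ] Matrix (Fin d) (Fin d) ℂ
  exists_kraus : ∃ m ≤ d ^ 2, ∃ K : Fin m → Matrix (Fin d) (Fin d) ℂ, IsKraus superOp K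
  init : Matrix (Fin d) (Fin d) ℂ
  init_isState : IsState init

/-- `lim_{n → ∞} 𝓔^{n θ}(ρ₀)` exists and is a quantum state. -/
def Chain.ConvergesAlong {d : ℕ} (G : Chain d) (θ : ℕ) : Prop :=
  ∃ ρ : Matrix (Fin d) (Fin d) ℂ, IsState ρ ∧
    Tendsto (fun n : ℕ => (G.superOp ^ (n * θ)) G.init) atTop (𝓝 ρ)

/-- Periodic stability. -/
def Chain.PeriodicallyStable {d : ℕ} (G : Chain d) : Prop :=
  ∃ θ : ℕ, 0 < θ ∧ G.ConvergesAlong θ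

/-- The period: the smallest `θ > 0` along which the chain converges
(meaningful for periodically stable chains only). -/
noncomputable def Chain.period {d : ℕ} (G : Chain d) : ℕ :=
  sInf {θ : ℕ | 0 < θ ∧ G.ConvergesAlong θ}

/-! ## The machine model

A random access machine with two memories: natural numbers (used also as addresses) and complex
numbers (addressed through the natural numbers).  Arithmetic is exact and has unit cost.  Besides
field arithmetic, conjugation and equality tests, the symbolic operations on complex numbers are the
extraction of one root of an explicitly given polynomial (charged the number of its coefficients)
and the order of a number as a root of unity.  There are no operations on matrices. -/

/-- The contents of the two memories. -/
structure Store where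
  nat : ℕ → ℕ
  cpx : ℕ → ℂ

def Store.setNat (s : Store) (a v : ℕ) : Store := ⟨Function.update s.nat a v, s.cpx⟩

noncomputable def Store.setCpx (s : Store) (a : ℕ) (v : ℂ) : Store :=
  ⟨s.nat, Function.update s.cpx a v⟩

/-- Binary operations on natural numbers (truncated subtraction, division rounded down). -/
inductive NatOp
  | plus | minus | times | quot | gcd

def NatOp.eval : NatOp → ℕ → ℕ → ℕ
  | .plus, a, b => a + b
  | .minus, a, b => a - b
  | .times, a, b => a * b
  | .quot, a, b => a / b
  | .gcd, a, b => Nat.gcd a b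

/-- Binary operations on complex numbers (division by zero returns zero). -/
inductive CpxOp
  | plus | minus | times | quot

noncomputable def CpxOp.eval : CpxOp → ℂ → ℂ → ℂ
  | .plus, a, b => a + b
  | .minus, a, b => a - b
  | .times, a, b => a * b
  | .quot, a, b => a / b

/-- The polynomial `∑_{i ≤ k} c_{b+i} Xⁱ` whose coefficients stand in the complex memory from
address `b` on. -/
noncomputable def Store.poly (s : Store) (b k : ℕ) : Polynomial ℂ :=
  ∑ i ∈ Finset.range (k + 1), Polynomial.C (s.cpx (b + i)) * Polynomial.X ^ i

/-- Some complex root of `p`, if there is one (no control over which one). -/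
noncomputable def someRoot (p : Polynomial ℂ) : ℂ :=
  Classical.epsilon fun z => p.IsRoot z

/-- Elementary instructions. Below `N[x]` is cell `x` of the natural-number memory and `Z[a]` is
cell `a` of the complex memory. -/
inductive Instr
  /-- `N[x] := c` -/
  | natConst (x c : ℕ)
  /-- `N[x] := N[y] ∘ N[z]` -/
  | natOp (o : NatOp) (x y z : ℕ)
  /-- `N[x] := N[N[y]]` -/
  | natLoad (x y : ℕ)
  /-- `N[N[x]] := N[y]` -/
  | natStore (x y : ℕ)
  /-- `Z[N[x]] := 1` -/
  | cpxOne (x : ℕ)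
  /-- `Z[N[x]] := Z[N[y]] ∘ Z[N[z]]` -/
  | cpxOp (o : CpxOp) (x y z : ℕ)
  /-- `Z[N[x]] :=` the complex conjugate of `Z[N[y]]` -/
  | cpxConj (x y : ℕ)
  /-- `Z[N[x]] :=` some root of `∑_{i ≤ N[k]} Z[N[y] + i] Xⁱ` -/
  | cpxRoot (x y k : ℕ)
  /-- `N[x] :=` the least `q ≥ 1` with `Z[N[y]] ^ q = 1`, or `0` if there is none -/
  | rootOrder (x y : ℕ)

/-- The effect of an instruction. -/
noncomputable def Instr.run : Instr → Store → Store
  | .natConst x c, s => s.setNat x c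
  | .natOp o x y z, s => s.setNat x (o.eval (s.nat y) (s.nat z))
  | .natLoad x y, s => s.setNat x (s.nat (s.nat y))
  | .natStore x y, s => s.setNat (s.nat x) (s.nat y)
  | .cpxOne x, s => s.setCpx (s.nat x) 1
  | .cpxOp o x y z, s => s.setCpx (s.nat x) (o.eval (s.cpx (s.nat y)) (s.cpx (s.nat z)))
  | .cpxConj x y, s => s.setCpx (s.nat x) (starRingEnd ℂ (s.cpx (s.nat y)))
  | .cpxRoot x y k, s => s.setCpx (s.nat x) (someRoot (s.poly (s.nat y) (s.nat k)))
  | .rootOrder x y, s => s.setNat x (orderOf (s.cpx (s.nat y)))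

/-- The time charged for an instruction. -/
def Instr.cost : Instr → Store → ℕ
  | .cpxRoot _ _ k, s => s.nat k + 1
  | _, _ => 1

/-- Elementary tests, at unit cost. -/
inductive Test
  /-- `N[x] < N[y]` -/
  | natLt (x y : ℕ)
  /-- `N[x] = N[y]` -/
  | natEq (x y : ℕ)
  /-- `Z[N[x]] = Z[N[y]]` -/
  | cpxEq (x y : ℕ)

def Test.Holds : Test → Store → Prop
  | .natLt x y, s => s.nat x < s.nat y
  | .natEq x y, s => s.nat x = s.nat y
  | .cpxEq x y, s => s.cpx (s.nat x) = s.cpx (s.nat y)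

/-- Programs. -/
inductive Prog
  | skip
  | instr (i : Instr)
  | seq (p q : Prog)
  | ifte (b : Test) (p q : Prog)
  | loop (b : Test) (p : Prog)

/-- `Exec p s s' t`: started in the store `s`, the program `p` halts in the store `s'` after time
`t`. (`loop b p` is the while loop.) -/
inductive Exec : Prog → Store → Store → ℕ → Prop
  | skip (s : Store) : Exec .skip s s 0
  | instr (i : Instr) (s : Store) : Exec (.instr i) s (i.run s) (i.cost s)
  | seq {p q : Prog} {s s' s'' : Store} {t t' : ℕ} :
      Exec p s s' t → Exec q s' s'' t' → Exec (.seq p q) s s'' (t + t')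
  | ifTrue {b : Test} {p q : Prog} {s s' : Store} {t : ℕ} :
      b.Holds s → Exec p s s' t → Exec (.ifte b p q) s s' (t + 1)
  | ifFalse {b : Test} {p q : Prog} {s s' : Store} {t : ℕ} :
      ¬ b.Holds s → Exec q s s' t → Exec (.ifte b p q) s s' (t + 1)
  | loopDone {b : Test} {p : Prog} {s : Store} :
      ¬ b.Holds s → Exec (.loop b p) s s 1
  | loopStep {b : Test} {p : Prog} {s s' s'' : Store} {t t' : ℕ} :
      b.Holds s → Exec p s s' t → Exec (.loop b p) s' s'' t' →
        Exec (.loop b p) s s'' (t + t' + 1)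

/-- Programs are deterministic: the final store and the running time are determined by the
initial store. -/
theorem Exec.deterministic {p : Prog} {s s₁ s₂ : Store} {t₁ t₂ : ℕ}
    (h₁ : Exec p s s₁ t₁) (h₂ : Exec p s s₂ t₂) : s₁ = s₂ ∧ t₁ = t₂ := by
  induction h₁ generalizing s₂ t₂ with
  | skip s => cases h₂; exact ⟨rfl, rfl⟩
  | instr i s => cases h₂; exact ⟨rfl, rfl⟩
  | seq _ _ ih ih' =>
    cases h₂ with
    | seq a b =>
      obtain ⟨rfl, rfl⟩ := ih a
      obtain ⟨rfl, rfl⟩ := ih' b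
      exact ⟨rfl, rfl⟩
  | ifTrue hb _ ih =>
    cases h₂ with
    | ifTrue _ a => obtain ⟨rfl, rfl⟩ := ih a; exact ⟨rfl, rfl⟩
    | ifFalse hn _ => exact absurd hb hn
  | ifFalse hb _ ih =>
    cases h₂ with
    | ifTrue hn _ => exact absurd hn hb
    | ifFalse _ a => obtain ⟨rfl, rfl⟩ := ih a; exact ⟨rfl, rfl⟩
  | loopDone hb =>
    cases h₂ with
    | loopDone _ => exact ⟨rfl, rfl⟩
    | loopStep hn _ _ => exact absurd hn hb
  | loopStep hb _ _ ih ih' =>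
    cases h₂ with
    | loopDone hn => exact absurd hb hn
    | loopStep _ a b =>
      obtain ⟨rfl, rfl⟩ := ih a
      obtain ⟨rfl, rfl⟩ := ih' b
      exact ⟨rfl, rfl⟩

/-- The store `s` holds the input consisting of `d`, `m`, the `d × d` matrices `K₀, …, K_{m-1}` and
the `d × d` matrix `ρ`: `N[0] = d`, `N[1] = m`, and the matrices are listed row by row, one after
the other, from cell `0` of the complex memory on. All other cells are arbitrary. -/
def Store.HoldsInput (s : Store) {d m : ℕ} (K : Fin m → Matrix (Fin d) (Fin d) ℂ)
    (ρ : Matrix (Fin d) (Fin d) ℂ) : Prop :=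
  s.nat 0 = d ∧ s.nat 1 = m ∧
    (∀ (k : Fin m) (i j : Fin d), s.cpx ((k : ℕ) * d ^ 2 + i * d + j) = K k i j) ∧
    ∀ i j : Fin d, s.cpx (m * d ^ 2 + i * d + j) = ρ i j

end QMC

/-! Write T for the super-operator and x for ρ₀. The orbit Tⁿx consists of states, so it is bounded,
and its asymptotics can be read off the minimal polynomial of x under T. Roots in the open unit disc
die out; boundedness rules out roots outside the closed disc and growth from multiple roots on the
circle. Hence T^(nθ)x converges iff μ^θ = 1 for every root μ of modulus 1
(`exists_tendsto_pow_mul_iff`, `Chain.convergesAlong_iff`). If L is the lcm of the orders of these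
roots, with order 0 for a number that is not a root of unity, the condition reads L ∣ θ. The chain
is therefore periodically stable iff L ≠ 0, and L is then the period.

The minimal polynomial of x is used, not the characteristic polynomial of T, because eigenvalues
that the orbit of x does not meet must not count. It is found, up to a power of X, by Gram-Schmidt
orthogonalization of the orbit, where each vector p(T)x is stored together with the coefficients of
p (`IsKrylovSequence.last`). The number of steps is always d²: once a vector vanishes, each further
step only multiplies p by X, which adds the harmless root 0, so no rank test is needed. The d² roots
are then split off one by one by root finding and synthetic division (`run_rootLoop`).

The cost is dominated by d² applications of T through the Kraus operators. Each computes d² entries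
as sums of m d² ≤ d⁴ terms, giving d⁸ in total; orthogonalization takes d⁶ and the roots take d⁴
(`time_le`, `run_periodProg`). -/

namespace QMC

/-! ### Asymptotics of orbits of a linear map. -/

section Orbits

variable {V : Type*} [NormedAddCommGroup V] [NormedSpace ℂ V]

theorem tendsto_zero_of_le_mul_add {a b : ℕ → ℝ} {r : ℝ} (ha : ∀ n, 0 ≤ a n) (hr0 : 0 ≤ r)
    (hr : r < 1) (h : ∀ n, a (n + 1) ≤ r * a n + b n) (hb : Tendsto b atTop (𝓝 0)) :
    Tendsto a atTop (𝓝 0) := by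
  rw [Metric.tendsto_atTop]
  intro ε hε
  -- The threshold for b is chosen so that r · ε/2 + ε/2 · (1 - r) = ε/2, which makes the bound
  -- `key` inductive.
  have hδ : 0 < ε / 2 * (1 - r) := by nlinarith
  obtain ⟨n₀, hn₀⟩ := (hb.eventually (gt_mem_nhds hδ)).exists_forall_of_atTop
  have key : ∀ k, a (n₀ + k) ≤ ε / 2 + r ^ k * a n₀ := by
    intro k
    induction k with
    | zero => simp; linarith
    | succ k ih =>
      have h1 := h (n₀ + k)
      have h2 := hn₀ (n₀ + k) (by omega)
      have h3 := mul_le_mul_of_nonneg_left ih hr0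
      rw [← add_assoc, pow_succ]
      nlinarith
  have ht : Tendsto (fun k => r ^ k * a n₀) atTop (𝓝 0) := by
    simpa using (tendsto_pow_atTop_nhds_zero_of_lt_one hr0 hr).mul_const (a n₀)
  obtain ⟨k₀, hk₀⟩ := (ht.eventually (gt_mem_nhds (half_pos hε))).exists_forall_of_atTop
  refine ⟨n₀ + k₀, fun n hn => ?_⟩
  obtain ⟨k, rfl⟩ := Nat.exists_eq_add_of_le (show n₀ ≤ n by omega)
  have := key k
  have := hk₀ k (by omega)
  rw [Real.dist_eq, sub_zero, abs_of_nonneg (ha _)]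
  linarith

/-- Linear factors are peeled off one at a time. With y = (T - a)x one has Tⁿ⁺¹x = a Tⁿx + Tⁿy, a
contraction by ‖a‖ < 1 perturbed by a null sequence. -/
theorem tendsto_pow_apply_zero (T : Module.End ℂ V) (M : Multiset ℂ) (hM : ∀ μ ∈ M, ‖μ‖ < 1) :
    ∀ x : V, Polynomial.aeval T (M.map fun μ => Polynomial.X - Polynomial.C μ).prod x = 0 →
      Tendsto (fun n => (T ^ n) x) atTop (𝓝 0) := by
  induction M using Multiset.induction_on with
  | empty =>
    intro x hx
    simp only [Multiset.map_zero, Multiset.prod_zero, map_one, Module.End.one_apply] at hx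
    simp [hx]
  | cons a M ih =>
    intro x hx
    rw [Multiset.map_cons, Multiset.prod_cons, mul_comm, map_mul, Module.End.mul_apply] at hx
    have h1 := ih (fun μ hμ => hM μ (Multiset.mem_cons_of_mem hμ)) _ hx
    rw [tendsto_zero_iff_norm_tendsto_zero] at h1 ⊢
    refine tendsto_zero_of_le_mul_add (fun _ => norm_nonneg _) (norm_nonneg a)
      (hM a (Multiset.mem_cons_self _ _)) (fun n => ?_) h1
    have : (T ^ (n + 1)) x = a • (T ^ n) x +
        (T ^ n) (Polynomial.aeval T (Polynomial.X - Polynomial.C a) x) := by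
      simp [pow_succ, Algebra.algebraMap_eq_smul_one]
    rw [this, ← norm_smul]
    exact norm_add_le _ _

theorem pow_apply_eq_of_sub_one_sq (T : Module.End ℂ V) {x : V} (hx : (T - 1) ((T - 1) x) = 0)
    (n : ℕ) : (T ^ n) x = x + (n : ℂ) • (T - 1) x := by
  induction n with
  | zero => simp
  | succ n ih =>
    have h : T ((T - 1) x) = (T - 1) x := by
      simpa [sub_eq_zero] using hx
    rw [pow_succ', Module.End.mul_apply, ih, map_add, map_smul, h]
    simp only [LinearMap.sub_apply, Module.End.one_apply]
    push_cast
    module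

/-- A nontrivial Jordan chain at the eigenvalue 1 makes the orbit grow. Induction, applied to (T -
1)x, reduces to a chain of length two, where growth is exactly linear in n. -/
theorem sub_one_apply_eq_zero_of_bounded (T : Module.End ℂ V) (a : ℕ) :
    ∀ x : V, (∃ c, ∀ n, ‖(T ^ n) x‖ ≤ c) → ((T - 1) ^ (a + 1)) x = 0 → (T - 1) x = 0 := by
  induction a with
  | zero => intro x _ hx; simpa using hx
  | succ a ih =>
    rintro x ⟨c, hc⟩ hx
    have h2 : (T - 1) ((T - 1) x) = 0 := by
      refine ih _ ⟨c + c, fun n => ?_⟩ (by rwa [pow_succ, Module.End.mul_apply] at hx)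
      have : (T ^ n) ((T - 1) x) = (T ^ (n + 1)) x - (T ^ n) x := by simp [pow_succ]
      rw [this]
      exact (norm_sub_le _ _).trans (add_le_add (hc _) (hc _))
    by_contra hne
    have hpos : 0 < ‖(T - 1) x‖ := norm_pos_iff.mpr hne
    obtain ⟨n, hn⟩ := exists_nat_gt ((c + ‖x‖) / ‖(T - 1) x‖)
    rw [div_lt_iff₀ hpos] at hn
    have h3 : (n : ℂ) • (T - 1) x = (T ^ n) x - x := by
      rw [pow_apply_eq_of_sub_one_sq T h2]; abel
    have h4 : (n : ℝ) * ‖(T - 1) x‖ ≤ c + ‖x‖ := by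
      have := congrArg norm h3
      rw [norm_smul, Complex.norm_natCast] at this
      rw [this]
      exact (norm_sub_le _ _).trans (add_le_add (hc _) le_rfl)
    linarith

/-- A bounded orbit converges if it is annihilated by a polynomial all of whose roots either lie in
the open unit disc or are equal to `1`. -/
theorem exists_tendsto_pow_apply (T : Module.End ℂ V) (M : Multiset ℂ)
    (hM : ∀ μ ∈ M, ‖μ‖ < 1 ∨ μ = 1) (x : V)
    (hb : ∀ q : Polynomial ℂ, ∃ c, ∀ n, ‖(T ^ n) (Polynomial.aeval T q x)‖ ≤ c)
    (hx : Polynomial.aeval T (M.map fun μ => Polynomial.X - Polynomial.C μ).prod x = 0) :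
    ∃ y, Tendsto (fun n => (T ^ n) x) atTop (𝓝 y) := by
  classical
  set Q : Polynomial ℂ :=
    ((M.filter fun μ => ¬ μ = 1).map fun μ => Polynomial.X - Polynomial.C μ).prod with hQ
  have hlt : ∀ μ ∈ M.filter (fun μ => ¬ μ = 1), ‖μ‖ < 1 := fun μ hμ => by
    rw [Multiset.mem_filter] at hμ
    exact (hM μ hμ.1).resolve_right hμ.2
  have hsub : Polynomial.aeval T (Polynomial.X - Polynomial.C (1 : ℂ)) = T - 1 := by simp
  have hfac : (M.map fun μ => Polynomial.X - Polynomial.C μ).prod =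
      (Polynomial.X - Polynomial.C (1 : ℂ)) ^ M.count 1 * Q := by
    conv_lhs => rw [← Multiset.filter_add_not (fun μ => μ = 1) M]
    rw [Multiset.map_add, Multiset.prod_add, Multiset.filter_eq', Multiset.map_replicate,
      Multiset.prod_replicate]
  -- Q(T)x is annihilated by a power of T - 1 and has a bounded orbit, so T fixes it. The exponent
  -- is one more than the multiplicity of the root 1, which covers multiplicity 0.
  have hz : (T - 1) (Polynomial.aeval T Q x) = 0 := by
    refine sub_one_apply_eq_zero_of_bounded T (M.count 1) _ (hb Q) ?_
    rw [hfac, map_mul, map_pow, hsub, Module.End.mul_apply] at hx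
    rw [pow_succ', Module.End.mul_apply, hx, map_zero]
  have hQ1 : Q.eval 1 ≠ 0 := by
    rw [hQ, Polynomial.eval_multiset_prod, Multiset.map_map]
    refine Multiset.prod_ne_zero fun h => ?_
    obtain ⟨μ, hμ, h0⟩ := Multiset.mem_map.mp h
    simp only [Function.comp, Polynomial.eval_sub, Polynomial.eval_X, Polynomial.eval_C,
      sub_eq_zero] at h0
    exact (Multiset.mem_filter.mp hμ).2 h0.symm
  -- Since X - 1 divides Q - Q(1), Q(T)x = Q(1)x + h(T)(T - 1)x. The left side is fixed by T and the
  -- last term is killed by Q(T), so its orbit tends to 0; dividing by Q(1) ≠ 0 gives the limit of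
  -- Tⁿx.
  obtain ⟨h, hh⟩ : Polynomial.X - Polynomial.C (1 : ℂ) ∣ Q - Polynomial.C (Q.eval 1) := by
    rw [Polynomial.dvd_iff_isRoot]; simp
  have hfix : ∀ n, (T ^ n) (Polynomial.aeval T Q x) = Polynomial.aeval T Q x := fun n => by
    rw [pow_apply_eq_of_sub_one_sq T (by rw [hz, map_zero]), hz, smul_zero, add_zero]
  have hdec : Polynomial.aeval T Q x =
      Q.eval 1 • x +
        Polynomial.aeval T h (Polynomial.aeval T (Polynomial.X - Polynomial.C (1 : ℂ)) x) := by
    rw [← Module.End.mul_apply, ← map_mul, mul_comm, ← hh]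
    simp [Algebra.algebraMap_eq_smul_one]
  have hy := tendsto_pow_apply_zero T _ hlt
    (Polynomial.aeval T h (Polynomial.aeval T (Polynomial.X - Polynomial.C (1 : ℂ)) x)) (by
      rw [← hQ, ← Module.End.mul_apply, ← Module.End.mul_apply, ← map_mul, ← map_mul,
        show Q * h * (Polynomial.X - Polynomial.C (1 : ℂ)) =
          h * ((Polynomial.X - Polynomial.C (1 : ℂ)) * Q) by ring,
        map_mul, map_mul, Module.End.mul_apply, Module.End.mul_apply, hsub, hz, map_zero])
  have hlim : Tendsto (fun n => (Q.eval 1)⁻¹ • (Polynomial.aeval T Q x -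
      (T ^ n) (Polynomial.aeval T h (Polynomial.aeval T (Polynomial.X - Polynomial.C (1 : ℂ)) x))))
      atTop
      (𝓝 ((Q.eval 1)⁻¹ • (Polynomial.aeval T Q x - 0))) := (hy.const_sub _).const_smul _
  refine ⟨_, hlim.congr fun n => ?_⟩
  have := hfix n
  rw [hdec, map_add, map_smul] at this
  conv_lhs => rw [hdec, ← this]
  rw [add_sub_cancel_right, smul_smul, inv_mul_cancel₀ hQ1, one_smul]

/-- The period of convergence of a bounded orbit: `Tᶿⁿ x` converges iff `θ` kills every unimodular
root `μ` of an annihilating polynomial, provided all nonzero roots are visible in the orbit of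
`x`. -/
theorem exists_tendsto_pow_mul_iff [FiniteDimensional ℂ V] (T : Module.End ℂ V)
    (M : Multiset ℂ) (x : V) (hb : ∃ c, ∀ n, ‖(T ^ n) x‖ ≤ c)
    (hx : Polynomial.aeval T (M.map fun μ => Polynomial.X - Polynomial.C μ).prod x = 0)
    (hM : ∀ μ ∈ M, μ ≠ 0 → ∃ q : Polynomial ℂ, Polynomial.aeval T q x ≠ 0 ∧
      T (Polynomial.aeval T q x) = μ • Polynomial.aeval T q x) {θ : ℕ} (hθ : 0 < θ) :
    (∃ y, Tendsto (fun n => (T ^ (n * θ)) x) atTop (𝓝 y)) ↔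
      ∀ μ ∈ M, ‖μ‖ = 1 → μ ^ θ = 1 := by
  have hcomm : ∀ (q : Polynomial ℂ) n, (T ^ n) (Polynomial.aeval T q x) =
      Polynomial.aeval T q ((T ^ n) x) := fun q n => by
    rw [← Polynomial.aeval_X (R := ℂ) T, ← map_pow, Polynomial.aeval_X, ← Module.End.mul_apply,
      ← map_mul, mul_comm, map_mul, Module.End.mul_apply]
  have hbq : ∀ q : Polynomial ℂ, ∃ c, ∀ n, ‖(T ^ n) (Polynomial.aeval T q x)‖ ≤ c := fun q => by
    obtain ⟨c, hc⟩ := hb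
    set F := LinearMap.toContinuousLinearMap (Polynomial.aeval T q) with hF
    refine ⟨‖F‖ * c, fun n => ?_⟩
    rw [hcomm]
    exact (F.le_opNorm _).trans (mul_le_mul_of_nonneg_left (hc n) (norm_nonneg _))
  have heig : ∀ (μ : ℂ) (v : V), T v = μ • v → ∀ n, (T ^ n) v = μ ^ n • v := fun μ v h n => by
    induction n with
    | zero => simp
    | succ n ih => rw [pow_succ', Module.End.mul_apply, ih, map_smul, h, smul_smul, pow_succ]
  -- A root outside the closed disc would have an eigenvector q(T)x, whose orbit is bounded with
  -- that of x but grows geometrically.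
  have hle : ∀ μ ∈ M, ‖μ‖ ≤ 1 := fun μ hμ => by
    by_contra hlt
    push Not at hlt
    obtain ⟨q, hq0, hq⟩ := hM μ hμ (by rintro rfl; simp at hlt; linarith)
    obtain ⟨c, hc⟩ := hbq q
    obtain ⟨n, hn⟩ := pow_unbounded_of_one_lt (c / ‖Polynomial.aeval T q x‖) hlt
    rw [div_lt_iff₀ (norm_pos_iff.mpr hq0)] at hn
    have := hc n
    rw [heig _ _ hq, norm_smul, norm_pow] at this
    linarith
  constructor
  -- Apply q(T) to the convergent sequence: μ^(nθ) v converges for an eigenvector v. The limit is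
  -- nonzero because the norm is constant, and shifting n by one multiplies it by μ^θ.
  · rintro ⟨y, hy⟩ μ hμ h1
    obtain ⟨q, hq0, hq⟩ := hM μ hμ (by rintro rfl; simp at h1)
    have hcont : Continuous (Polynomial.aeval T q) :=
      LinearMap.continuous_of_finiteDimensional (Polynomial.aeval T q)
    have h2 : Tendsto (fun n : ℕ => μ ^ (n * θ) • Polynomial.aeval T q x) atTop
        (𝓝 (Polynomial.aeval T q y)) :=
      ((hcont.tendsto y).comp hy).congr fun n => by
        simp only [Function.comp]; rw [← hcomm, heig _ _ hq]
    have h3 : Tendsto (fun n : ℕ => μ ^ ((n + 1) * θ) • Polynomial.aeval T q x) atTop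
        (𝓝 (Polynomial.aeval T q y)) := h2.comp (tendsto_add_atTop_nat 1)
    have h4 := tendsto_nhds_unique h3 ((h2.const_smul (μ ^ θ)).congr fun n => by
      rw [smul_smul, ← pow_add, add_mul, one_mul, add_comm])
    have h5 : ‖Polynomial.aeval T q y‖ = ‖Polynomial.aeval T q x‖ :=
      tendsto_nhds_unique h2.norm (by simp [norm_smul, h1])
    have h6 : Polynomial.aeval T q y ≠ 0 := by
      rw [← norm_pos_iff, h5]; exact norm_pos_iff.mpr hq0
    have h7 : (1 - μ ^ θ) • Polynomial.aeval T q y = 0 := by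
      rw [sub_smul, one_smul, ← h4, sub_self]
    exact (sub_eq_zero.mp ((smul_eq_zero.mp h7).resolve_right h6)).symm
  · intro h
    have hpow : ∀ n, (T ^ θ) ^ n = T ^ (n * θ) := fun n => by rw [← pow_mul, mul_comm]
    simp only [← hpow]
    refine exists_tendsto_pow_apply (T ^ θ) (M.map (· ^ θ)) ?_ x ?_ ?_
    · intro μ hμ
      obtain ⟨ν, hν, rfl⟩ := Multiset.mem_map.mp hμ
      rcases (hle ν hν).lt_or_eq with h1 | h1
      · left; rw [norm_pow]; exact pow_lt_one₀ (norm_nonneg _) h1 hθ.ne'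
      · right; exact h ν hν h1
    · intro q
      obtain ⟨c, hc⟩ := hbq (q.comp (Polynomial.X ^ θ))
      refine ⟨c, fun n => ?_⟩
      rw [hpow]
      simpa [Polynomial.aeval_comp] using hc (n * θ)
    -- Because X - μ divides X^θ - μ^θ, the polynomial with roots μ^θ, evaluated at T^θ, still
    -- annihilates x.
    · have hd : ∀ M : Multiset ℂ, (M.map fun μ => Polynomial.X - Polynomial.C μ).prod ∣
          (((M.map (· ^ θ)).map fun μ => Polynomial.X - Polynomial.C μ).prod).comp
            (Polynomial.X ^ θ) := fun M => by
        induction M using Multiset.induction_on with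
        | empty => simp
        | cons a M ih =>
          simp only [Multiset.map_cons, Multiset.prod_cons, Polynomial.mul_comp]
          refine mul_dvd_mul ?_ ih
          simpa using sub_dvd_pow_sub_pow (Polynomial.X : Polynomial ℂ) (Polynomial.C a) θ
      obtain ⟨g, hg⟩ := hd M
      have : Polynomial.aeval (T ^ θ) (((M.map (· ^ θ)).map fun μ =>
          Polynomial.X - Polynomial.C μ).prod) = Polynomial.aeval T
          ((((M.map (· ^ θ)).map fun μ => Polynomial.X - Polynomial.C μ).prod).comp
            (Polynomial.X ^ θ)) := by simp [Polynomial.aeval_comp]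
      rw [this, hg, mul_comm, map_mul, Module.End.mul_apply, hx, map_zero]

end Orbits

/-! ### Compactness properties of quantum states. -/

section States

attribute [local instance] Matrix.normedAddCommGroup Matrix.normedSpace

variable {d : ℕ}

/-- Write ρ = B†B. The trace is the sum of the squared norms of the columns of B, so each column has
norm at most 1, and the entries of ρ are inner products of columns. The norm here is the largest
absolute value of an entry. -/
theorem IsState.norm_le_one {ρ : Matrix (Fin d) (Fin d) ℂ} (h : IsState ρ) : ‖ρ‖ ≤ 1 := by
  open scoped MatrixOrder in
  obtain ⟨B, hB⟩ := CStarAlgebra.nonneg_iff_eq_star_mul_self.mp h.1.nonneg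
  have htr : ∑ i, ∑ k, ‖B k i‖ ^ 2 = 1 := by
    have h1 := h.2
    rw [hB, Matrix.trace] at h1
    have h2 : ((∑ i, ∑ k, ‖B k i‖ ^ 2 : ℝ) : ℂ) = 1 := by
      rw [← h1]
      push_cast
      refine Finset.sum_congr rfl fun i _ => ?_
      rw [Matrix.diag_apply, Matrix.mul_apply]
      refine Finset.sum_congr rfl fun k _ => ?_
      rw [Matrix.star_apply, RCLike.star_def, Complex.conj_mul']
    exact_mod_cast h2
  have hcol : ∀ i, ∑ k, ‖B k i‖ ^ 2 ≤ 1 := fun i => htr ▸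
    Finset.single_le_sum (f := fun i => ∑ k, ‖B k i‖ ^ 2)
      (fun i _ => Finset.sum_nonneg fun k _ => sq_nonneg _) (Finset.mem_univ i)
  refine (Matrix.norm_le_iff zero_le_one).mpr fun i j => ?_
  rw [hB, Matrix.mul_apply]
  calc ‖∑ k, (star B) i k * B k j‖ ≤ ∑ k, ‖B k i‖ * ‖B k j‖ :=
        (norm_sum_le _ _).trans_eq (Finset.sum_congr rfl fun k _ => by
          rw [norm_mul, Matrix.star_apply, norm_star])
    _ ≤ ∑ k, (‖B k i‖ ^ 2 + ‖B k j‖ ^ 2) / 2 := Finset.sum_le_sum fun k _ => by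
          nlinarith [sq_nonneg (‖B k i‖ - ‖B k j‖)]
    _ ≤ 1 := by
          rw [← Finset.sum_div, Finset.sum_add_distrib]
          linarith [hcol i, hcol j]

/-- Each defining condition is closed. Consequently any limit of the orbit is automatically a state,
and only existence of the limit has to be decided. -/
theorem isState_of_tendsto {f : ℕ → Matrix (Fin d) (Fin d) ℂ} {ρ : Matrix (Fin d) (Fin d) ℂ}
    (hf : ∀ n, IsState (f n)) (h : Tendsto f atTop (𝓝 ρ)) : IsState ρ := by
  refine ⟨Matrix.posSemidef_iff_dotProduct_mulVec.mpr ⟨?_, fun x => ?_⟩, ?_⟩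
  · exact tendsto_nhds_unique (((continuous_id.matrix_conjTranspose).tendsto ρ).comp h)
      (h.congr fun n => (hf n).1.isHermitian.symm)
  · have hc : Continuous fun M : Matrix (Fin d) (Fin d) ℂ => star x ⬝ᵥ (M *ᵥ x) := by fun_prop
    exact ge_of_tendsto' ((hc.tendsto ρ).comp h) fun n => (hf n).1.dotProduct_mulVec_nonneg x
  · exact tendsto_nhds_unique (((continuous_id.matrix_trace).tendsto ρ).comp h)
      (tendsto_const_nhds.congr fun n => (hf n).2.symm)

theorem Chain.isState_superOp (G : Chain d) {ρ : Matrix (Fin d) (Fin d) ℂ} (h : IsState ρ) :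
    IsState (G.superOp ρ) := by
  obtain ⟨m, -, K, hK, hK1⟩ := G.exists_kraus
  rw [hK]
  refine ⟨Matrix.posSemidef_sum _ fun k _ => h.1.mul_mul_conjTranspose_same _, ?_⟩
  rw [Matrix.trace_sum]
  simp_rw [Matrix.trace_mul_comm _ (K _)ᴴ, ← Matrix.mul_assoc]
  rw [← Matrix.trace_sum, ← Finset.sum_mul, hK1, one_mul, h.2]

theorem Chain.isState_pow (G : Chain d) (n : ℕ) : IsState ((G.superOp ^ n) G.init) := by
  induction n with
  | zero => simpa using G.init_isState
  | succ n ih => rw [pow_succ', Module.End.mul_apply]; exact G.isState_superOp ih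

theorem Chain.convergesAlong_iff (G : Chain d) (M : Multiset ℂ)
    (hx : Polynomial.aeval G.superOp (M.map fun μ => Polynomial.X - Polynomial.C μ).prod G.init = 0)
    (hM : ∀ μ ∈ M, μ ≠ 0 → ∃ q : Polynomial ℂ, Polynomial.aeval G.superOp q G.init ≠ 0 ∧
      G.superOp (Polynomial.aeval G.superOp q G.init) = μ • Polynomial.aeval G.superOp q G.init)
    {θ : ℕ} (hθ : 0 < θ) :
    G.ConvergesAlong θ ↔ ∀ μ ∈ M, ‖μ‖ = 1 → μ ^ θ = 1 := by
  rw [← exists_tendsto_pow_mul_iff G.superOp M G.init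
    ⟨1, fun n => (G.isState_pow n).norm_le_one⟩ hx hM hθ]
  exact ⟨fun ⟨ρ, _, h⟩ => ⟨ρ, h⟩,
    fun ⟨ρ, h⟩ => ⟨ρ, isState_of_tendsto (fun n => G.isState_pow _) h, h⟩⟩

end States

/-! ### From divisibility by L to stability and period. -/

section Period

variable {d : ℕ} {G : Chain d} {L : ℕ}

/-- The value L = 0 encodes instability, since 0 divides no positive θ. -/
theorem Chain.periodicallyStable_iff_ne_zero
    (h : ∀ θ, 0 < θ → (G.ConvergesAlong θ ↔ L ∣ θ)) : G.PeriodicallyStable ↔ L ≠ 0 := by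
  constructor
  · rintro ⟨θ, hθ, hc⟩ rfl
    exact hθ.ne' (Nat.eq_zero_of_zero_dvd ((h θ hθ).mp hc))
  · intro hL
    exact ⟨L, Nat.pos_of_ne_zero hL, (h L (Nat.pos_of_ne_zero hL)).mpr dvd_rfl⟩

theorem Chain.period_eq (h : ∀ θ, 0 < θ → (G.ConvergesAlong θ ↔ L ∣ θ))
    (hG : G.PeriodicallyStable) : G.period = L := by
  have hL := Nat.pos_of_ne_zero ((Chain.periodicallyStable_iff_ne_zero h).mp hG)
  have hmem : L ∈ {θ : ℕ | 0 < θ ∧ G.ConvergesAlong θ} := ⟨hL, (h L hL).mpr dvd_rfl⟩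
  refine le_antisymm (Nat.sInf_le hmem) (le_csInf ⟨L, hmem⟩ fun θ hθ => ?_)
  exact Nat.le_of_dvd hθ.1 ((h θ hθ.1).mp hθ.2)

end Period

/-! ### Orthogonalized orbits and minimal polynomials. -/

section Krylov

variable {d : ℕ}

/-- The Hilbert-Schmidt inner product. -/
noncomputable def hsInner (u w : Matrix (Fin d) (Fin d) ℂ) : ℂ :=
  ∑ i, ∑ j, starRingEnd ℂ (u i j) * w i j

theorem hsInner_add (u v w : Matrix (Fin d) (Fin d) ℂ) :
    hsInner u (v + w) = hsInner u v + hsInner u w := by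
  simp [hsInner, mul_add, Finset.sum_add_distrib]

theorem hsInner_smul (u w : Matrix (Fin d) (Fin d) ℂ) (c : ℂ) :
    hsInner u (c • w) = c * hsInner u w := by
  simp [hsInner, Finset.mul_sum, mul_left_comm]

theorem hsInner_sub (u v w : Matrix (Fin d) (Fin d) ℂ) :
    hsInner u (v - w) = hsInner u v - hsInner u w := by
  simp [hsInner, mul_sub, Finset.sum_sub_distrib]

theorem hsInner_zero_right (u : Matrix (Fin d) (Fin d) ℂ) : hsInner u 0 = 0 := by simp [hsInner]

theorem conj_hsInner (u w : Matrix (Fin d) (Fin d) ℂ) :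
    starRingEnd ℂ (hsInner u w) = hsInner w u := by
  simp [hsInner, mul_comm]

theorem hsInner_self_eq_zero {u : Matrix (Fin d) (Fin d) ℂ} : hsInner u u = 0 ↔ u = 0 := by
  constructor
  · intro h
    have h2 : ((∑ i, ∑ j, ‖u i j‖ ^ 2 : ℝ) : ℂ) = 0 := by
      rw [← h, hsInner]
      push_cast
      simp only [Complex.conj_mul']
    have h3 : ∑ i, ∑ j, ‖u i j‖ ^ 2 = 0 := by exact_mod_cast h2
    ext i j
    have h4 := (Finset.sum_eq_zero_iff_of_nonneg fun i _ =>
      Finset.sum_nonneg fun j _ => sq_nonneg ‖u i j‖).mp h3 i (Finset.mem_univ i)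
    have h5 := (Finset.sum_eq_zero_iff_of_nonneg fun j _ => sq_nonneg ‖u i j‖).mp h4 j
      (Finset.mem_univ j)
    simpa using h5
  · rintro rfl; exact hsInner_zero_right _

/-- Otherwise d² + 1 nonzero pairwise orthogonal vectors would be independent in a space of
dimension d². -/
theorem exists_eq_zero_of_orthogonal (u : ℕ → Matrix (Fin d) (Fin d) ℂ)
    (h : ∀ i j, i < j → j ≤ d * d → hsInner (u i) (u j) = 0) : ∃ r ≤ d * d, u r = 0 := by
  by_contra! hne
  have hli : LinearIndependent ℂ fun i : Fin (d * d + 1) => u i := by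
    rw [Fintype.linearIndependent_iff]
    intro c hc i
    have hs : ∀ s : Finset (Fin (d * d + 1)), hsInner (u i) (∑ j ∈ s, c j • u j) =
        ∑ j ∈ s, c j * hsInner (u i) (u j) := fun s => by
      induction s using Finset.induction_on with
      | empty => simp [hsInner_zero_right]
      | insert a s ha ih => rw [Finset.sum_insert ha, Finset.sum_insert ha, hsInner_add,
          hsInner_smul, ih]
    have h1 := hs Finset.univ
    rw [hc, hsInner_zero_right, Finset.sum_eq_single i] at h1
    · refine (mul_eq_zero.mp h1.symm).resolve_right fun h0 => ?_
      exact hne i (by omega) (hsInner_self_eq_zero.mp h0)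
    · intro j _ hji
      rcases lt_or_gt_of_ne (fun h : (j : ℕ) = i => hji (Fin.ext h)) with hlt | hlt
      · rw [← conj_hsInner, h _ _ hlt (by omega), map_zero, mul_zero]
      · rw [h _ _ hlt (by omega), mul_zero]
    · simp
  have := hli.fintype_card_le_finrank
  simp [Module.finrank_matrix] at this

/-- The polynomials produced by orthogonalizing the orbit of `x` under `T`. -/
structure IsKrylovSequence (T : Module.End ℂ (Matrix (Fin d) (Fin d) ℂ))
    (x : Matrix (Fin d) (Fin d) ℂ) (p : ℕ → Polynomial ℂ) (n : ℕ) : Prop where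
  monic : ∀ k ≤ n, (p k).Monic
  natDegree : ∀ k ≤ n, (p k).natDegree = k
  orthogonal : ∀ i j, i < j → j ≤ n →
    hsInner (Polynomial.aeval T (p i) x) (Polynomial.aeval T (p j) x) = 0
  -- After the orbit is exhausted the polynomials only gain factors X, so no nonzero root is
  -- created.
  succ : ∀ k < n, Polynomial.aeval T (p k) x = 0 → p (k + 1) = Polynomial.X * p k

variable {T : Module.End ℂ (Matrix (Fin d) (Fin d) ℂ)} {x : Matrix (Fin d) (Fin d) ℂ}
  {p : ℕ → Polynomial ℂ} {n : ℕ}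

/-- Monic polynomials of degrees 0, …, i - 1 span all polynomials of degree below i; the induction
removes the leading term of q. -/
theorem IsKrylovSequence.hsInner_eq_zero (h : IsKrylovSequence T x p n) {k : ℕ} (hk : k ≤ n) :
    ∀ i ≤ k, ∀ q : Polynomial ℂ, q.degree < i →
      hsInner (Polynomial.aeval T (p k) x) (Polynomial.aeval T q x) = 0 := by
  intro i
  induction i with
  | zero =>
    intro _ q hq
    have : q = 0 := by simpa [Polynomial.degree_eq_bot] using hq
    rw [this, map_zero, LinearMap.zero_apply, hsInner_zero_right]
  | succ i ih =>
    intro hi q hq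
    set q' := q - Polynomial.C (q.coeff i) * p i with hq'
    have hm := h.monic i (by omega)
    have hn := h.natDegree i (by omega)
    have hdeg : q'.degree < i := by
      rw [Polynomial.degree_lt_iff_coeff_zero]
      intro j hj
      rw [hq', Polynomial.coeff_sub, Polynomial.coeff_C_mul]
      rcases hj.eq_or_lt with rfl | hlt
      · have : (p i).coeff i = 1 := by
          have := hm.coeff_natDegree
          rwa [hn] at this
        rw [this, mul_one, sub_self]
      · rw [(Polynomial.degree_lt_iff_coeff_zero _ _).mp hq j (by exact_mod_cast hlt),
          Polynomial.coeff_eq_zero_of_natDegree_lt (p := p i) (by omega), mul_zero, sub_zero]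
    have hsum : q = Polynomial.C (q.coeff i) * p i + q' := by rw [hq']; ring
    have hz : hsInner (Polynomial.aeval T (p k) x) (Polynomial.aeval T (p i) x) = 0 := by
      rw [← conj_hsInner, h.orthogonal i k (by omega) hk, map_zero]
    have hA : Polynomial.aeval T q x =
        q.coeff i • Polynomial.aeval T (p i) x + Polynomial.aeval T q' x := by
      conv_lhs => rw [hsum]
      simp [Algebra.algebraMap_eq_smul_one]
    rw [hA, hsInner_add, hsInner_smul, hz, ih (by omega) q' hdeg]
    simp

/-- No polynomial of degree below the first vanishing index can annihilate x: pairing q(T)x with the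
row of the same degree isolates the leading coefficient of q times a nonzero square norm. -/
theorem IsKrylovSequence.aeval_ne_zero (h : IsKrylovSequence T x p n) {r : ℕ} (hr : r ≤ n)
    (hne : ∀ k < r, Polynomial.aeval T (p k) x ≠ 0) {q : Polynomial ℂ} (hq : q ≠ 0)
    (hdeg : q.natDegree < r) : Polynomial.aeval T q x ≠ 0 := by
  set k := q.natDegree with hk
  set q' := q - Polynomial.C (q.coeff k) * p k with hq'
  have hm := h.monic k (by omega)
  have hn := h.natDegree k (by omega)
  have hck : (p k).coeff k = 1 := by
    have := hm.coeff_natDegree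
    rwa [hn] at this
  have hdeg' : q'.degree < k := by
    rw [Polynomial.degree_lt_iff_coeff_zero]
    intro j hj
    rw [hq', Polynomial.coeff_sub, Polynomial.coeff_C_mul]
    rcases hj.eq_or_lt with hjk | hlt
    · rw [← hjk, hck, mul_one, sub_self]
    · rw [Polynomial.coeff_eq_zero_of_natDegree_lt (by omega),
        Polynomial.coeff_eq_zero_of_natDegree_lt (p := p k) (by omega), mul_zero, sub_zero]
  have hsum : q = Polynomial.C (q.coeff k) * p k + q' := by rw [hq']; ring
  have hA : Polynomial.aeval T q x =
      q.coeff k • Polynomial.aeval T (p k) x + Polynomial.aeval T q' x := by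
    conv_lhs => rw [hsum]
    simp [Algebra.algebraMap_eq_smul_one]
  intro h0
  have h1 : hsInner (Polynomial.aeval T (p k) x) (Polynomial.aeval T q x) = 0 := by
    rw [h0, hsInner_zero_right]
  rw [hA, hsInner_add, hsInner_smul, h.hsInner_eq_zero (by omega) k le_rfl q' hdeg', add_zero,
    mul_eq_zero, hsInner_self_eq_zero] at h1
  exact h1.elim (fun h => hq (Polynomial.leadingCoeff_eq_zero.mp h)) (hne k hdeg)

/-- The last polynomial of a complete Krylov sequence annihilates `x`, and its nonzero roots are
eigenvalues visible from `x`. -/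
theorem IsKrylovSequence.last (h : IsKrylovSequence T x p (d * d)) :
    Polynomial.aeval T (p (d * d)) x = 0 ∧ ∀ μ, (p (d * d)).IsRoot μ → μ ≠ 0 →
      ∃ q : Polynomial ℂ, Polynomial.aeval T q x ≠ 0 ∧
        T (Polynomial.aeval T q x) = μ • Polynomial.aeval T q x := by
  classical
  have hex := exists_eq_zero_of_orthogonal (fun k => Polynomial.aeval T (p k) x) h.orthogonal
  set r := Nat.find hex with hr
  obtain ⟨hrn, hr0⟩ := Nat.find_spec hex
  rw [← hr] at hrn hr0
  have hlt : ∀ k < r, Polynomial.aeval T (p k) x ≠ 0 := fun k hk h0 =>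
    Nat.find_min hex hk ⟨by omega, h0⟩
  -- From the first vanishing index r on, the sequence is `p r` times powers of X, and `p r` plays
  -- the role of the minimal polynomial of x.
  have hpow : ∀ e, r + e ≤ d * d → p (r + e) = Polynomial.X ^ e * p r := by
    intro e
    induction e with
    | zero => simp
    | succ e ih =>
      intro he
      have := ih (by omega)
      rw [← add_assoc, h.succ (r + e) (by omega), this, pow_succ', mul_assoc]
      rw [this, map_mul, Module.End.mul_apply, hr0, map_zero]
  obtain ⟨e, he⟩ := Nat.exists_eq_add_of_le hrn
  have hp : p (d * d) = Polynomial.X ^ e * p r := by rw [he]; exact hpow e he.ge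
  refine ⟨by rw [hp, map_mul, Module.End.mul_apply, hr0, map_zero], fun μ hμ hμ0 => ?_⟩
  have hroot : (p r).IsRoot μ := by
    rw [hp, Polynomial.IsRoot, Polynomial.eval_mul, mul_eq_zero] at hμ
    exact hμ.resolve_left (by simp [hμ0])
  -- The cofactor q of X - μ has degree below r, so q(T)x is nonzero, while (T - μ)q(T)x = 0: this
  -- is the required eigenvector.
  obtain ⟨q, hq⟩ := Polynomial.dvd_iff_isRoot.mpr hroot
  have hpr : p r ≠ 0 := (h.monic r hrn).ne_zero
  have hq0 : q ≠ 0 := by rintro rfl; exact hpr (by rw [hq, mul_zero])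
  have hdeg : q.natDegree < r := by
    have := h.natDegree r hrn
    rw [hq, Polynomial.natDegree_mul (Polynomial.X_sub_C_ne_zero μ) hq0,
      Polynomial.natDegree_X_sub_C] at this
    omega
  refine ⟨q, h.aeval_ne_zero hrn hlt hq0 hdeg, ?_⟩
  rw [hq, map_mul, Module.End.mul_apply] at hr0
  simpa [Algebra.algebraMap_eq_smul_one, sub_eq_zero] using hr0

end Krylov

/-! ### Program logic with time bounds. -/

section Logic

/-- Started in `s`, the program `P` halts after time at most `b` in a store satisfying `Q`. -/
def Run (P : Prog) (s : Store) (b : ℕ) (Q : Store → Prop) : Prop :=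
  ∃ s' t, Exec P s s' t ∧ t ≤ b ∧ Q s'

variable {P P' : Prog} {s : Store} {b b' : ℕ} {Q Q' : Store → Prop}

theorem Run.mono (h : Run P s b Q) (hb : b ≤ b') (hQ : ∀ s, Q s → Q' s) : Run P s b' Q' := by
  obtain ⟨s', t, he, ht, hs⟩ := h
  exact ⟨s', t, he, ht.trans hb, hQ _ hs⟩

theorem Run.seq (h : Run P s b fun s' => Run P' s' b' Q) : Run (.seq P P') s (b + b') Q := by
  obtain ⟨s', t, he, ht, s'', t', he', ht', hQ⟩ := h
  exact ⟨s'', t + t', .seq he he', add_le_add ht ht', hQ⟩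

theorem Run.skip (h : Q s) : Run .skip s 0 Q := ⟨s, 0, .skip s, le_rfl, h⟩

theorem Run.instr {i : Instr} (hb : i.cost s ≤ b) (h : Q (i.run s)) : Run (.instr i) s b Q :=
  ⟨_, _, .instr i s, hb, h⟩

theorem Run.ifte {c : Test} (ht : c.Holds s → Run P s b Q) (hf : ¬ c.Holds s → Run P' s b Q) :
    Run (.ifte c P P') s (b + 1) Q := by
  by_cases hc : c.Holds s
  · obtain ⟨s', t, he, hb, hQ⟩ := ht hc
    exact ⟨s', t + 1, .ifTrue hc he, by omega, hQ⟩
  · obtain ⟨s', t, he, hb, hQ⟩ := hf hc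
    exact ⟨s', t + 1, .ifFalse hc he, by omega, hQ⟩

/-- Straight-line programs. -/
def block : List Instr → Prog
  | [] => .skip
  | i :: l => .seq (.instr i) (block l)

/-- Instructions of unit cost. -/
def Instr.Unit : Instr → Prop
  | .cpxRoot _ _ _ => False
  | _ => True

theorem Instr.Unit.cost_eq {i : Instr} (h : i.Unit) (s : Store) : i.cost s = 1 := by
  cases i <;> first | rfl | exact h.elim

theorem Run.block {l : List Instr} (hl : l.length ≤ b) (hu : ∀ i ∈ l, i.Unit)
    (h : Q (l.foldl (fun s i => i.run s) s)) : Run (block l) s b Q := by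
  induction l generalizing s b with
  | nil => exact (Run.skip h).mono (Nat.zero_le _) fun _ => id
  | cons i l ih =>
    have h1 : Run (QMC.block l) (i.run s) l.length Q :=
      ih le_rfl (fun j hj => hu j (List.mem_cons_of_mem _ hj)) h
    refine (Run.seq (Run.instr (b := 1) ((hu i List.mem_cons_self).cost_eq s).le h1)).mono ?_
      fun _ => id
    rw [List.length_cons] at hl
    omega

/-- The instruction writes no register below `n`. -/
def Instr.Above (n : ℕ) : Instr → Prop
  | .natConst x _ | .natOp _ x _ _ | .natLoad x _ | .rootOrder x _ => n ≤ x
  | .natStore _ _ => False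
  | _ => True

theorem foldl_run_nat {n : ℕ} {l : List Instr} (hl : ∀ i ∈ l, i.Above n) {s s' : Store}
    (h : l.foldl (fun s i => i.run s) s = s') : ∀ r < n, s'.nat r = s.nat r := by
  subst h
  intro r hr
  induction l generalizing s with
  | nil => rfl
  | cons i l ih =>
    rw [List.foldl_cons, ih fun j hj => hl j (List.mem_cons_of_mem _ hj)]
    have hi := hl i List.mem_cons_self
    cases i <;> first
      | exact Function.update_of_ne (hr.trans_le hi).ne _ _
      | rfl
      | exact hi.elim

/-- The final store is made a variable, with the untouched registers recorded, so that later proofs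
can extract the few changed cells and forget the instructions. -/
theorem Run.block' {l : List Instr} (n : ℕ) (hl : l.length ≤ b) (hu : ∀ i ∈ l, i.Unit)
    (hn : ∀ i ∈ l, i.Above n)
    (h : ∀ s', l.foldl (fun s i => i.run s) s = s' → (∀ r < n, s'.nat r = s.nat r) → Q s') :
    Run (QMC.block l) s b Q :=
  Run.block hl hu (h _ rfl (foldl_run_nat hn rfl))

/-- `for N[i] := 0, …, N[y] - 1 do body` -/
def forLoop (i y : ℕ) (body : Prog) : Prog :=
  .seq (.instr (.natConst i 0)) (.loop (.natLt i y)
    (.seq body (block [.natConst 99 1, .natOp .plus i i 99])))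

/-- Register 99 holds the constant 1 for the increment, hence the invariant must tolerate writes to
it and to the counter. Each round costs the body, two instructions and a test; the final 2 pays for
initialization and the failing test. -/
theorem Run.forLoop_general {i y n : ℕ} {body : Prog} (I : ℕ → Store → Prop) (hi : i < 99)
    (hstab : ∀ k s v w, I k s → I k ((s.setNat 99 v).setNat i w))
    (h0 : I 0 s) (hy : ∀ k s, I k s → s.nat y = n)
    (hbody : ∀ k < n, ∀ s, s.nat i = k → I k s →
      Run body s b fun s' => s'.nat i = k ∧ I (k + 1) s')
    (hQ : ∀ s, I n s → Q s) : Run (forLoop i y body) s (n * (b + 3) + 2) Q := by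
  have key : ∀ e k s, k + e = n → s.nat i = k → I k s →
      Run (.loop (.natLt i y) (.seq body (QMC.block [.natConst 99 1, .natOp .plus i i 99]))) s
        (e * (b + 3) + 1) (fun s => I n s) := by
    intro e
    induction e with
    | zero =>
      intro k s hk hsk hI
      obtain rfl : k = n := by omega
      refine ⟨s, 1, .loopDone ?_, by omega, hI⟩
      simp only [Test.Holds]
      rw [hsk, hy _ _ hI]
      omega
    | succ e ih =>
      intro k s hk hsk hI
      have hb : Run (.seq body (QMC.block [.natConst 99 1, .natOp .plus i i 99])) s (b + 2)
          fun s' => s'.nat i = k + 1 ∧ I (k + 1) s' := by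
        refine Run.seq ((hbody k (by omega) s hsk hI).mono le_rfl fun s' hs' => ?_)
        refine Run.block (by simp) (by simp [Instr.Unit]) ⟨?_, ?_⟩
        · simp [Instr.run, Store.setNat, NatOp.eval, hi.ne, hs'.1]
        · exact hstab _ _ _ _ hs'.2
      obtain ⟨s', t, he, ht, hs', hI'⟩ := hb
      obtain ⟨s'', t', he', ht', hQ'⟩ := ih (k + 1) s' (by omega) hs' hI'
      refine ⟨s'', t + t' + 1, .loopStep ?_ he he', ?_, hQ'⟩
      · simp only [Test.Holds]
        rw [hsk, hy _ _ hI]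
        omega
      · rw [add_mul]; omega
  have h1 : I 0 (s.setNat i 0) := by
    -- Only the counter is to change, so register 99 is overwritten with its own value.
    have h2 := hstab 0 s (s.nat 99) 0 h0
    rwa [show s.setNat 99 (s.nat 99) = s by simp [Store.setNat]] at h2
  refine (Run.seq (Run.instr (b := 1) le_rfl ((key n 0 (s.setNat i 0) (by omega) ?_ h1).mono
    le_rfl hQ))).mono (by omega) fun _ => id
  simp [Store.setNat]

/-- Loops whose only observable effect is on the complex memory. Registers below the counter are
preserved. -/
theorem Run.forLoop {i y : ℕ} {body : Prog} (I : ℕ → (ℕ → ℂ) → Prop) (hi : i < 99) (hy : y < i)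
    (h0 : I 0 s.cpx)
    (hbody : ∀ k < s.nat y, ∀ s', (∀ r < i, s'.nat r = s.nat r) → s'.nat i = k → I k s'.cpx →
      Run body s' b fun s'' => (∀ r ≤ i, s''.nat r = s'.nat r) ∧ I (k + 1) s''.cpx) :
    Run (forLoop i y body) s (s.nat y * (b + 3) + 2) fun s' =>
      (∀ r < i, s'.nat r = s.nat r) ∧ I (s.nat y) s'.cpx := by
  refine Run.forLoop_general (fun k s' => (∀ r < i, s'.nat r = s.nat r) ∧ I k s'.cpx) hi ?_
    ⟨fun _ _ => rfl, h0⟩ (fun k s' h => h.1 y hy) ?_ fun _ => id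
  · rintro k s' v w ⟨h1, h2⟩
    refine ⟨fun r hr => ?_, h2⟩
    rw [← h1 r hr]
    simp [Store.setNat, hr.ne, (hr.trans hi).ne]
  · rintro k hk s' hs' ⟨h1, h2⟩
    refine (hbody k hk s' h1 hs' h2).mono le_rfl fun s'' h => ⟨(h.1 i le_rfl).trans hs', ?_, h.2⟩
    exact fun r hr => (h.1 r hr.le).trans (h1 r hr)

end Logic

/-! ### Flattened indices and memory layout. -/

section Sums

variable {α : Type*} [AddCommMonoid α]

theorem sum_range_mul (f : ℕ → α) (m n : ℕ) :
    ∑ z ∈ Finset.range (m * n), f z = ∑ i : Fin m, ∑ j : Fin n, f (i * n + j) := by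
  rw [← Fin.sum_univ_eq_sum_range, ← finProdFinEquiv.sum_comp, Fintype.sum_prod_type]
  simp [finProdFinEquiv, add_comm, mul_comm]

end Sums

/-- The fixed registers of the programs: `N[3] = d²`, the address `N[4]` of the first row, the width
`N[5]` of the rows, the addresses `N[6], …, N[9]` of four auxiliary complex cells, and
`N[10] = d² + 1`. -/
structure Regs (d m : ℕ) (s : Store) : Prop where
  r0 : s.nat 0 = d
  r1 : s.nat 1 = m
  r3 : s.nat 3 = d * d
  r4 : s.nat 4 = m * (d * d)
  r5 : s.nat 5 = 2 * (d * d) + 1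
  r6 : s.nat 6 = m * (d * d) + (d * d + 2) * (2 * (d * d) + 1)
  r7 : s.nat 7 = s.nat 6 + 1
  r8 : s.nat 8 = s.nat 6 + 2
  r9 : s.nat 9 = s.nat 6 + 3
  r10 : s.nat 10 = d * d + 1

theorem Regs.congr {d m : ℕ} {s s' : Store} (h : Regs d m s) (hs : ∀ r < 11, s'.nat r = s.nat r) :
    Regs d m s' := by
  obtain ⟨h0, h1, h3, h4, h5, h6, h7, h8, h9, h10⟩ := h
  constructor <;> simp only [hs _ (by norm_num : (0 : ℕ) < 11), hs _ (by norm_num : (1 : ℕ) < 11),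
    hs _ (by norm_num : (3 : ℕ) < 11), hs _ (by norm_num : (4 : ℕ) < 11),
    hs _ (by norm_num : (5 : ℕ) < 11), hs _ (by norm_num : (6 : ℕ) < 11),
    hs _ (by norm_num : (7 : ℕ) < 11), hs _ (by norm_num : (8 : ℕ) < 11),
    hs _ (by norm_num : (9 : ℕ) < 11), hs _ (by norm_num : (10 : ℕ) < 11), *]

/-- The `d × d` matrix `u` stands in the complex memory from address `a` on. -/
def MatAt {d : ℕ} (c : ℕ → ℂ) (a : ℕ) (u : Matrix (Fin d) (Fin d) ℂ) : Prop :=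
  ∀ i j : Fin d, c (a + (i * d + j)) = u i j

theorem index_lt {d : ℕ} (i j : Fin d) : (i : ℕ) * d + j < d * d := by
  have h1 := i.isLt
  have h2 := j.isLt
  nlinarith [Nat.mul_le_mul_right d (Nat.succ_le_of_lt h1)]

theorem mul_add_div_of_lt {k n r : ℕ} (h : r < n) : (k * n + r) / n = k := by
  rw [mul_comm, Nat.mul_add_div (by omega), Nat.div_eq_of_lt h, add_zero]

/-! ### Application of the super-operator -/

/-- One summand of an entry of `∑ₖ Kₖ u Kₖ†`. -/
def applyBody : Prog := block
  [.natOp .quot 25 24 3, .natOp .times 25 25 3, .natOp .minus 26 24 25, .natOp .quot 27 26 0,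
    .natOp .times 28 27 0, .natOp .minus 28 26 28, .natOp .plus 30 25 22, .natOp .plus 30 30 27,
    .natOp .plus 31 25 23, .natOp .plus 31 31 28, .natOp .plus 32 13 26,
    .cpxConj 8 31, .cpxOp .times 8 8 32, .cpxOp .times 8 8 30, .cpxOp .plus 21 21 8]

/-- Writes the matrix `∑ₖ Kₖ u Kₖ†` from address `N[14]` on, where `u` stands from address `N[13]`
on. -/
def applyProg : Prog :=
  forLoop 20 3 <| .seq
    (block [.natOp .plus 21 14 20, .cpxOp .minus 21 21 21, .natOp .quot 22 20 0,
      .natOp .times 22 22 0, .natOp .minus 23 20 22, .natOp .times 23 23 0])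
    (forLoop 24 4 applyBody)

variable {d m : ℕ} {K : Fin m → Matrix (Fin d) (Fin d) ℂ} {u : Matrix (Fin d) (Fin d) ℂ}

/-- The Kraus operators stand in the complex memory from address `0` on. -/
def KrausAt (c : ℕ → ℂ) (K : Fin m → Matrix (Fin d) (Fin d) ℂ) : Prop :=
  ∀ k : Fin m, MatAt c (k * (d * d)) (K k)

/-- The `z`-th summand of entry number `x` of `∑ₖ Kₖ u Kₖ†`, where `u` stands from address `a`
on. -/
noncomputable def applyTerm (c : ℕ → ℂ) (d a x z : ℕ) : ℂ :=
  let k := z / (d * d) * (d * d)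
  let y := z - k
  starRingEnd ℂ (c (k + (x - x / d * d) * d + (y - y / d * d))) * c (a + y) *
    c (k + x / d * d + y / d)

/-- Division with remainder decodes the entry number as i d + j and z as k d² + p d + q; the term is
then `K k i p * u p q` times the conjugate of `K k j q`. -/
theorem sum_applyTerm {c : ℕ → ℂ} {a : ℕ} (hK : KrausAt c K) (hu : MatAt c a u) (i j : Fin d) :
    ∑ z ∈ Finset.range (m * (d * d)), applyTerm c d a (i * d + j) z =
      (∑ k, K k * u * (K k)ᴴ) i j := by
  rw [sum_range_mul, Matrix.sum_apply]
  refine Finset.sum_congr rfl fun k _ => ?_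
  rw [Fin.sum_univ_eq_sum_range fun y => applyTerm c d a (i * d + j) (k * (d * d) + y),
    sum_range_mul, Matrix.mul_apply]
  simp only [Matrix.mul_apply, Finset.sum_mul]
  rw [Finset.sum_comm]
  refine Finset.sum_congr rfl fun q _ => Finset.sum_congr rfl fun p _ => ?_
  simp only [applyTerm]
  rw [mul_add_div_of_lt (index_lt p q), Nat.add_sub_cancel_left, mul_add_div_of_lt j.isLt,
    mul_add_div_of_lt q.isLt, Nat.add_sub_cancel_left, Nat.add_sub_cancel_left]
  have h1 := hK k i p
  have h2 := hK k j q
  rw [← add_assoc] at h1 h2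
  rw [h1, h2, hu p q, Matrix.conjTranspose_apply, RCLike.star_def]
  ring

theorem applyTerm_index_lt {x z : ℕ} (hx : x < d * d) (hz : z < m * (d * d)) :
    let k := z / (d * d) * (d * d)
    let y := z - k
    k + (x - x / d * d) * d + (y - y / d * d) < m * (d * d) ∧ y < d * d ∧
      k + x / d * d + y / d < m * (d * d) := by
  intro k y
  have hN : 0 < d * d := by omega
  have hd : 0 < d := Nat.pos_of_mul_pos_left hN
  have hk : k + d * d ≤ m * (d * d) := by
    have := Nat.mul_le_mul_right (d * d) (Nat.succ_le_of_lt ((Nat.div_lt_iff_lt_mul hN).mpr hz))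
    rwa [Nat.succ_mul] at this
  have hm := Nat.div_add_mod' z (d * d)
  have hm' := Nat.mod_lt z hN
  have hy : y < d * d := by omega
  have hx1 := Nat.div_add_mod' x d
  have hx2 := Nat.mod_lt x hd
  have hy1 := Nat.div_add_mod' y d
  have hy2 := Nat.mod_lt y hd
  have e1 := index_lt (d := d) ⟨x - x / d * d, by omega⟩ ⟨y - y / d * d, by omega⟩
  have e2 := index_lt (d := d) ⟨x / d, (Nat.div_lt_iff_lt_mul hd).mpr hx⟩
    ⟨y / d, (Nat.div_lt_iff_lt_mul hd).mpr hy⟩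
  simp only at e1 e2
  omega

theorem applyTerm_congr {c c' : ℕ → ℂ} {a b x z : ℕ} (hb : m * (d * d) ≤ b) (ha : a + d * d ≤ b)
    (hx : x < d * d) (hz : z < m * (d * d)) (h : ∀ i < b, c' i = c i) :
    applyTerm c' d a x z = applyTerm c d a x z := by
  obtain ⟨e1, e2, e3⟩ := applyTerm_index_lt hx hz
  simp only [applyTerm]
  rw [h _ (by omega), h _ (by omega), h _ (by omega)]

/-- The destination lies above the operators and the source and below the scratch cells, so no write
destroys data still to be read. -/
theorem run_applyProg {s : Store} (hr : Regs d m s) (hK : KrausAt s.cpx K)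
    (hu : MatAt s.cpx (s.nat 13) u) (h1 : m * (d * d) ≤ s.nat 14)
    (h2 : s.nat 13 + d * d ≤ s.nat 14) (h3 : s.nat 14 + d * d ≤ s.nat 6) :
    Run applyProg s (d * d * (m * (d * d) * 18 + 11) + 2) fun s' => (∀ r < 20, s'.nat r = s.nat r) ∧
      (∀ a < s.nat 14, s'.cpx a = s.cpx a) ∧ MatAt s'.cpx (s.nat 14) (∑ k, K k * u * (K k)ᴴ) := by
  have key := Run.forLoop (s := s) (i := 20) (y := 3) (b := 6 + (m * (d * d) * 18 + 2))
    (body := .seq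
    (block [.natOp .plus 21 14 20, .cpxOp .minus 21 21 21, .natOp .quot 22 20 0,
      .natOp .times 22 22 0, .natOp .minus 23 20 22, .natOp .times 23 23 0])
    (forLoop 24 4 applyBody))
    (fun n c => (∀ a < s.nat 14, c a = s.cpx a) ∧ ∀ x < n, c (s.nat 14 + x) =
      ∑ z ∈ Finset.range (m * (d * d)), applyTerm s.cpx d (s.nat 13) x z)
    (by norm_num) (by norm_num) ⟨fun _ _ => rfl, by simp⟩ ?_
  · rw [hr.r3] at key
    refine key.mono (by rw [show 6 + (m * (d * d) * 18 + 2) + 3 = m * (d * d) * 18 + 11 by ring])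
      fun s' hs' => ⟨hs'.1, hs'.2.1, fun i j => ?_⟩
    rw [hs'.2.2 _ (index_lt i j), sum_applyTerm hK hu]
  · rintro x hx s1 hs1 hx1 ⟨hlo, hdone⟩
    rw [hr.r3] at hx
    have hr1 := hr.congr fun r h => hs1 r (by omega)
    have e13 := hs1 13 (by norm_num)
    have e14 := hs1 14 (by norm_num)
    refine Run.seq (Run.block' 21 (by simp) (by simp [Instr.Unit]) (by simp [Instr.Above]) ?_)
    intro s2 hs2 hf2
    have e21 : s2.nat 21 = s.nat 14 + x := by
      rw [← hs2]; simp [Instr.run, Store.setNat, Store.setCpx, NatOp.eval, hx1, e14]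
    have e22 : s2.nat 22 = x / d * d := by
      rw [← hs2]; simp [Instr.run, Store.setNat, Store.setCpx, NatOp.eval, hx1, hr1.r0]
    have e23 : s2.nat 23 = (x - x / d * d) * d := by
      rw [← hs2]; simp [Instr.run, Store.setNat, Store.setCpx, NatOp.eval, hx1, hr1.r0]
    -- Subtracting the accumulator from itself gives it the initial value 0.
    have hc2 : s2.cpx = Function.update s1.cpx (s.nat 14 + x) 0 := by
      rw [← hs2]; simp [Instr.run, Store.setNat, Store.setCpx, NatOp.eval, CpxOp.eval, hx1, e14]
    clear hs2
    have hr2 := hr1.congr fun r h => hf2 r (by omega)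
    have key2 := Run.forLoop (s := s2) (i := 24) (y := 4) (b := 15) (body := applyBody)
      (fun n c => (∀ a < s.nat 6, a ≠ s.nat 14 + x → c a = s1.cpx a) ∧ c (s.nat 14 + x) =
        ∑ z ∈ Finset.range n, applyTerm s.cpx d (s.nat 13) x z) (by norm_num) (by norm_num)
      ⟨fun a _ ha => by rw [hc2, Function.update_of_ne ha], by rw [hc2]; simp⟩ ?_
    · rw [hr2.r4] at key2
      refine key2.mono le_rfl fun s3 hs3 => ⟨fun r hr => ?_, ?_, ?_⟩
      · rw [hs3.1 r (by omega), hf2 r (by omega)]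
      · intro a ha
        rw [hs3.2.1 a (by omega) (by omega), hlo a ha]
      · intro y hy
        rcases Nat.lt_succ_iff_lt_or_eq.mp hy with hy | rfl
        · rw [hs3.2.1 _ (by omega) (by omega), hdone y hy]
        · exact hs3.2.2
    · rintro z hz s3 hs3 hz3 ⟨hlo3, hacc3⟩
      rw [hr2.r4] at hz
      have hr3 := hr2.congr fun r h => hs3 r (by omega)
      refine Run.block' 25 (by simp) (by simp [Instr.Unit]) (by simp [Instr.Above]) ?_
      intro s4 hs4 hf4
      refine ⟨fun r hr => hf4 r (by omega), ?_⟩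
      have e13' : s3.nat 13 = s.nat 13 := by rw [hs3 _ (by norm_num), hf2 _ (by norm_num), e13]
      have e6 : s3.nat 6 = s.nat 6 := by rw [hr3.r6, hr.r6]
      have hT : applyTerm s3.cpx d (s.nat 13) x z = applyTerm s.cpx d (s.nat 13) x z :=
        applyTerm_congr h1 h2 hx hz fun i hi => by rw [hlo3 i (by omega) (by omega), hlo i hi]
      have hc4 : s4.cpx = Function.update (Function.update s3.cpx (s.nat 6 + 2)
          (applyTerm s3.cpx d (s.nat 13) x z)) (s.nat 14 + x)
          (s3.cpx (s.nat 14 + x) + applyTerm s3.cpx d (s.nat 13) x z) := by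
        have e21' : s3.nat 21 = s.nat 14 + x := by rw [hs3 _ (by norm_num), e21]
        have e22' : s3.nat 22 = x / d * d := by rw [hs3 _ (by norm_num), e22]
        have e23' : s3.nat 23 = (x - x / d * d) * d := by rw [hs3 _ (by norm_num), e23]
        obtain ⟨b1, b2, b3⟩ := applyTerm_index_lt hx hz
        -- The scratch cell already holds a partial product when the remaining factors and the
        -- accumulator are read, so these must lie elsewhere.
        have n1 := (show s.nat 13 + (z - z / (d * d) * (d * d)) < s.nat 6 + 2 by omega).ne
        have n2 := (b3.trans (show m * (d * d) < s.nat 6 + 2 by omega)).ne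
        have n3 := (show s.nat 14 + x < s.nat 6 + 2 by omega).ne
        rw [← hs4]
        simp [Instr.run, Store.setNat, Store.setCpx, NatOp.eval, CpxOp.eval, hz3, hr3.r0,
          hr3.r3, hr3.r8, e6, e13', e21', e22', e23', applyTerm, n1, n2, n3]
      rw [hc4]
      refine ⟨fun a ha hax => ?_, ?_⟩
      · rw [Function.update_of_ne hax, Function.update_of_ne (by omega), hlo3 a ha hax]
      · rw [Function.update_self, hacc3, hT, Finset.sum_range_succ]

/-! ### Rows pairing a vector p(T)x with the coefficients of p. -/

section Rows

variable {d m : ℕ} {T : Module.End ℂ (Matrix (Fin d) (Fin d) ℂ)} {x u : Matrix (Fin d) (Fin d) ℂ}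
  {c c' : ℕ → ℂ} {a b : ℕ} {p q w : Polynomial ℂ}

theorem MatAt.congr (h : MatAt c a u) (hab : a + d * d ≤ b) (hc : ∀ i < b, c' i = c i) :
    MatAt c' a u := fun i j => by
  rw [hc _ (by have := index_lt i j; omega), h i j]

theorem KrausAt.congr {K : Fin m → Matrix (Fin d) (Fin d) ℂ} (h : KrausAt c K)
    (hb : m * (d * d) ≤ b) (hc : ∀ i < b, c' i = c i) : KrausAt c' K := fun k =>
  (h k).congr (by
    have := Nat.mul_le_mul_right (d * d) (Nat.succ_le_of_lt k.isLt)
    rw [Nat.succ_mul] at this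
    omega) hc

/-- The row from address `a` on: the matrix `p(T) x`, followed by the coefficients of `p`. -/
def RowAt (T : Module.End ℂ (Matrix (Fin d) (Fin d) ℂ)) (x : Matrix (Fin d) (Fin d) ℂ)
    (c : ℕ → ℂ) (a : ℕ) (p : Polynomial ℂ) : Prop :=
  MatAt c a (Polynomial.aeval T p x) ∧ ∀ i ≤ d * d, c (a + d * d + i) = p.coeff i

theorem RowAt.congr (h : RowAt T x c a p) (hab : a + (2 * (d * d) + 1) ≤ b)
    (hc : ∀ i < b, c' i = c i) : RowAt T x c' a p :=
  ⟨h.1.congr (by omega) hc, fun i hi => by rw [hc _ (by omega), h.2 i hi]⟩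

theorem sum_eq_hsInner {v : Matrix (Fin d) (Fin d) ℂ} (hu : MatAt c a u) (hv : MatAt c b v) :
    ∑ y ∈ Finset.range (d * d), starRingEnd ℂ (c (a + y)) * c (b + y) = hsInner u v := by
  rw [sum_range_mul, hsInner]
  exact Finset.sum_congr rfl fun i _ => Finset.sum_congr rfl fun j _ => by rw [hu, hv]

/-! ### One orthogonalization step -/

/-- Accumulates the inner products of the row at `N[17]` with the row at `N[14]` and with
itself. -/
def dotProg : Prog := forLoop 20 3 <| block
  [.natOp .plus 21 17 20, .natOp .plus 22 14 20, .cpxConj 8 21, .cpxOp .times 9 8 22,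
    .cpxOp .plus 6 6 9, .cpxOp .times 9 8 21, .cpxOp .plus 7 7 9]

/-- Subtracts `Z[N[6]]` times the row at `N[17]` from the row at `N[14]`. -/
def axpyProg : Prog := forLoop 20 5 <| block
  [.natOp .plus 21 17 20, .natOp .plus 22 14 20, .cpxOp .times 8 6 21, .cpxOp .minus 22 22 8]

/-- Makes the row at `N[14]` orthogonal to row number `N[16]`. -/
def orthBody : Prog :=
  .seq (block [.natOp .times 17 16 5, .natOp .plus 17 4 17, .cpxOp .minus 6 6 6,
    .cpxOp .minus 7 7 7])
  (.seq dotProg (.seq (block [.cpxOp .quot 6 6 7]) axpyProg))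

theorem run_dotProg {s : Store} (hr : Regs d m s) (h6 : s.cpx (s.nat 6) = 0)
    (h7 : s.cpx (s.nat 6 + 1) = 0) (h1 : s.nat 17 + d * d ≤ s.nat 6)
    (h2 : s.nat 14 + d * d ≤ s.nat 6) :
    Run dotProg s (d * d * 10 + 2) fun s' => (∀ r < 20, s'.nat r = s.nat r) ∧
      (∀ a < s.nat 6, s'.cpx a = s.cpx a) ∧
      s'.cpx (s.nat 6) = ∑ y ∈ Finset.range (d * d),
        starRingEnd ℂ (s.cpx (s.nat 17 + y)) * s.cpx (s.nat 14 + y) ∧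
      s'.cpx (s.nat 6 + 1) = ∑ y ∈ Finset.range (d * d),
        starRingEnd ℂ (s.cpx (s.nat 17 + y)) * s.cpx (s.nat 17 + y) := by
  have key := Run.forLoop (s := s) (i := 20) (y := 3) (b := 7)
    (body := block [.natOp .plus 21 17 20, .natOp .plus 22 14 20, .cpxConj 8 21,
      .cpxOp .times 9 8 22, .cpxOp .plus 6 6 9, .cpxOp .times 9 8 21, .cpxOp .plus 7 7 9])
    (fun n c => (∀ a < s.nat 6, c a = s.cpx a) ∧
      c (s.nat 6) = ∑ y ∈ Finset.range n,
        starRingEnd ℂ (s.cpx (s.nat 17 + y)) * s.cpx (s.nat 14 + y) ∧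
      c (s.nat 6 + 1) = ∑ y ∈ Finset.range n,
        starRingEnd ℂ (s.cpx (s.nat 17 + y)) * s.cpx (s.nat 17 + y)) (by norm_num) (by norm_num)
    ⟨fun _ _ => rfl, by simpa using h6, by simpa using h7⟩ ?_
  · rw [hr.r3] at key
    exact key
  · rintro y hy s1 hs1 hy1 ⟨hlo, hA, hB⟩
    rw [hr.r3] at hy
    have hr1 := hr.congr fun r h => hs1 r (by omega)
    have e6 := hs1 6 (by norm_num)
    have e14 := hs1 14 (by norm_num)
    have e17 := hs1 17 (by norm_num)
    refine Run.block' 21 (by simp) (by simp [Instr.Unit]) (by simp [Instr.Above]) ?_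
    intro s2 hs2 hf2
    refine ⟨fun r h => hf2 r (by omega), ?_⟩
    have n1 : ∀ i, s.nat 17 + y ≠ s.nat 6 + i := fun i => by omega
    have n2 : ∀ i, s.nat 14 + y ≠ s.nat 6 + i := fun i => by omega
    have n3 := n1 0
    rw [add_zero] at n3
    rw [Finset.sum_range_succ, Finset.sum_range_succ, ← hA, ← hB, ← hlo (s.nat 17 + y) (by omega),
      ← hlo (s.nat 14 + y) (by omega), ← hs2]
    refine ⟨fun a ha => ?_, ?_, ?_⟩
    · rw [← hlo a ha]
      have m1 : ∀ i, a ≠ s.nat 6 + i := fun i => by omega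
      have m2 := ha.ne
      simp [Instr.run, Store.setNat, Store.setCpx, NatOp.eval, CpxOp.eval, hr1.r7, hr1.r8, hr1.r9,
        e6, m1, m2]
    · simp [Instr.run, Store.setNat, Store.setCpx, NatOp.eval, CpxOp.eval, hr1.r7, hr1.r8, hr1.r9,
        e6, e14, e17, hy1, n1, n2, n3]
    · simp [Instr.run, Store.setNat, Store.setCpx, NatOp.eval, CpxOp.eval, hr1.r7, hr1.r8, hr1.r9,
        e6, e14, e17, hy1, n1, n2, n3]

theorem run_axpyProg {s : Store} (hr : Regs d m s)
    (h1 : s.nat 17 + (2 * (d * d) + 1) ≤ s.nat 14) (h2 : s.nat 14 + (2 * (d * d) + 1) ≤ s.nat 6) :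
    Run axpyProg s ((2 * (d * d) + 1) * 7 + 2) fun s' => (∀ r < 20, s'.nat r = s.nat r) ∧
      (∀ a < s.nat 14, s'.cpx a = s.cpx a) ∧ ∀ y < 2 * (d * d) + 1, s'.cpx (s.nat 14 + y) =
        s.cpx (s.nat 14 + y) - s.cpx (s.nat 6) * s.cpx (s.nat 17 + y) := by
  have key := Run.forLoop (s := s) (i := 20) (y := 5) (b := 4)
    (body := block [.natOp .plus 21 17 20, .natOp .plus 22 14 20, .cpxOp .times 8 6 21,
      .cpxOp .minus 22 22 8])
    (fun n c => (∀ a < s.nat 14, c a = s.cpx a) ∧ c (s.nat 6) = s.cpx (s.nat 6) ∧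
      ∀ y < 2 * (d * d) + 1, c (s.nat 14 + y) = if y < n then
        s.cpx (s.nat 14 + y) - s.cpx (s.nat 6) * s.cpx (s.nat 17 + y) else s.cpx (s.nat 14 + y))
    (by norm_num) (by norm_num) ⟨fun _ _ => rfl, rfl, by simp⟩ ?_
  · rw [hr.r5] at key
    exact key.mono le_rfl fun s' h => ⟨h.1, h.2.1, fun y hy => by rw [h.2.2.2 y hy, if_pos hy]⟩
  · rintro y hy s1 hs1 hy1 ⟨hlo, hA, hB⟩
    rw [hr.r5] at hy
    have hr1 := hr.congr fun r h => hs1 r (by omega)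
    have e6 := hs1 6 (by norm_num)
    have e14 := hs1 14 (by norm_num)
    have e17 := hs1 17 (by norm_num)
    refine Run.block' 21 (by simp) (by simp [Instr.Unit]) (by simp [Instr.Above]) ?_
    intro s2 hs2 hf2
    refine ⟨fun r h => hf2 r (by omega), ?_⟩
    have hc2 : s2.cpx = Function.update (Function.update s1.cpx (s.nat 6 + 2)
        (s.cpx (s.nat 6) * s.cpx (s.nat 17 + y))) (s.nat 14 + y)
        (s.cpx (s.nat 14 + y) - s.cpx (s.nat 6) * s.cpx (s.nat 17 + y)) := by
      have n1 := (show s.nat 14 + y < s.nat 6 + 2 by omega).ne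
      have n2 := hB y hy
      rw [if_neg (lt_irrefl _)] at n2
      rw [← hs2, ← hA, ← hlo (s.nat 17 + y) (by omega), ← n2]
      simp [Instr.run, Store.setNat, Store.setCpx, NatOp.eval, CpxOp.eval, hr1.r8, e6, e14, e17,
        hy1, n1]
    rw [hc2]
    refine ⟨fun a ha => ?_, ?_, fun z hz => ?_⟩
    · rw [Function.update_of_ne (by omega), Function.update_of_ne (by omega), hlo a ha]
    · rw [Function.update_of_ne (by omega), Function.update_of_ne (by omega), hA]
    · rcases eq_or_ne z y with rfl | hne
      · rw [Function.update_self, if_pos (by omega)]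
      · rw [Function.update_of_ne (by omega), Function.update_of_ne (by omega), hB z hz]
        have : z < y ↔ z < y + 1 := by omega
        simp only [this]

/-- Since p ↦ p(T)x is linear, a single subtraction of rows updates the vector and the coefficients
consistently. -/
theorem run_orthBody {s : Store} (hr : Regs d m s) {j : ℕ} (hj : s.nat 16 = j)
    (hq : RowAt T x s.cpx (m * (d * d) + j * (2 * (d * d) + 1)) q)
    (hw : RowAt T x s.cpx (s.nat 14) w)
    (h1 : m * (d * d) + j * (2 * (d * d) + 1) + (2 * (d * d) + 1) ≤ s.nat 14)
    (h2 : s.nat 14 + (2 * (d * d) + 1) ≤ s.nat 6) :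
    Run orthBody s (d * d * 24 + 16) fun s' => (∀ r ≤ 16, s'.nat r = s.nat r) ∧
      (∀ a < s.nat 14, s'.cpx a = s.cpx a) ∧ RowAt T x s'.cpx (s.nat 14)
        (w - Polynomial.C (hsInner (Polynomial.aeval T q x) (Polynomial.aeval T w x) /
          hsInner (Polynomial.aeval T q x) (Polynomial.aeval T q x)) * q) := by
  refine Run.mono (b := 4 + ((d * d * 10 + 2) + (1 + ((2 * (d * d) + 1) * 7 + 2)))) ?_ (by omega)
    fun _ => id
  refine Run.seq (Run.block' 17 (by simp) (by simp [Instr.Unit]) (by simp [Instr.Above]) ?_)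
  intro s1 hs1 hf1
  have hr1 := hr.congr fun r h => hf1 r (by omega)
  have e6 := hf1 6 (by norm_num)
  have e14 := hf1 14 (by norm_num)
  have e17 : s1.nat 17 = m * (d * d) + j * (2 * (d * d) + 1) := by
    rw [← hs1]; simp [Instr.run, Store.setNat, Store.setCpx, NatOp.eval, hj, hr.r4, hr.r5]
  have hc1 : s1.cpx = Function.update (Function.update s.cpx (s.nat 6) 0) (s.nat 6 + 1) 0 := by
    rw [← hs1]
    simp [Instr.run, Store.setNat, Store.setCpx, NatOp.eval, CpxOp.eval, hr.r7]
  have hlo1 : ∀ a < s.nat 6, s1.cpx a = s.cpx a := fun a ha => by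
    rw [hc1, Function.update_of_ne (by omega), Function.update_of_ne (by omega)]
  refine Run.seq ((run_dotProg hr1 (by rw [hc1, e6]; simp) (by rw [hc1, e6]; simp) (by omega)
    (by omega)).mono le_rfl ?_)
  rintro s2 ⟨hf2, hlo2, hA, hB⟩
  have hq1 := hq.congr (by omega) hlo1
  have hw1 := hw.congr (by omega) hlo1
  rw [sum_eq_hsInner (e17 ▸ hq1.1) (e14 ▸ hw1.1)] at hA
  rw [sum_eq_hsInner (e17 ▸ hq1.1) (e17 ▸ hq1.1)] at hB
  have hr2 := hr1.congr fun r h => hf2 r (by omega)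
  refine Run.seq (Run.block' 20 (by simp) (by simp [Instr.Unit]) (by simp [Instr.Above]) ?_)
  intro s3 hs3 hf3
  have g6 : s2.nat 6 = s.nat 6 := by rw [hf2 _ (by norm_num), e6]
  have f6 : s3.nat 6 = s.nat 6 := by rw [hf3 _ (by norm_num), g6]
  have f14 : s3.nat 14 = s.nat 14 := by rw [hf3 _ (by norm_num), hf2 _ (by norm_num), e14]
  have f17 : s3.nat 17 = m * (d * d) + j * (2 * (d * d) + 1) := by
    rw [hf3 _ (by norm_num), hf2 _ (by norm_num), e17]
  rw [e6] at hA hB hlo2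
  have hc3 : s3.cpx = Function.update s2.cpx (s.nat 6)
      (hsInner (Polynomial.aeval T q x) (Polynomial.aeval T w x) /
        hsInner (Polynomial.aeval T q x) (Polynomial.aeval T q x)) := by
    rw [← hs3]
    simp [Instr.run, Store.setCpx, CpxOp.eval, hr2.r7, g6, hA, hB]
  have hlo3 : ∀ a < s.nat 6, s3.cpx a = s.cpx a := fun a ha => by
    rw [hc3, Function.update_of_ne ha.ne, hlo2 a ha, hlo1 a ha]
  have hr3 := hr2.congr fun r h => hf3 r (by omega)
  refine (run_axpyProg hr3 (by omega) (by omega)).mono le_rfl ?_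
  rintro s4 ⟨hf4, hlo4, hrow⟩
  rw [f14] at hlo4 hrow
  rw [f6, f17, hc3, Function.update_self, ← hc3] at hrow
  refine ⟨fun r h => ?_, fun a ha => ?_, fun i k => ?_, fun i hi => ?_⟩
  · rw [hf4 r (by omega), hf3 r (by omega), hf2 r (by omega), hf1 r (by omega)]
  · rw [hlo4 a ha, hlo3 a (by omega)]
  · have hik := index_lt i k
    rw [hrow _ (by omega), hlo3 _ (by omega), hlo3 _ (by omega), hw.1 i k, hq.1 i k]
    simp [Algebra.algebraMap_eq_smul_one]
  · rw [add_assoc, hrow _ (by omega), hlo3 _ (by omega), hlo3 _ (by omega), ← add_assoc,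
      hw.2 i hi, ← add_assoc, hq.2 i hi]
    simp

/-! ### The Krylov sequence -/

/-- The row at `N[14]` receives the coefficients of `X p`, where `p` is the polynomial of the row
at `N[13]`. -/
def shiftProg : Prog :=
  .seq (block [.natOp .plus 20 14 3, .cpxOp .minus 20 20 20]) <| forLoop 20 3 <| block
    [.natOp .plus 21 13 3, .natOp .plus 21 21 20, .natOp .plus 22 14 10, .natOp .plus 22 22 20,
      .cpxOne 8, .cpxOp .times 22 21 8]

theorem run_shiftProg {s : Store} (hr : Regs d m s)
    (hp : ∀ i ≤ d * d, s.cpx (s.nat 13 + d * d + i) = p.coeff i)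
    (h1 : s.nat 13 + (2 * (d * d) + 1) ≤ s.nat 14) (h2 : s.nat 14 + (2 * (d * d) + 1) ≤ s.nat 6) :
    Run shiftProg s (d * d * 9 + 4) fun s' => (∀ r < 20, s'.nat r = s.nat r) ∧
      (∀ a < s.nat 14 + d * d, s'.cpx a = s.cpx a) ∧
      ∀ i ≤ d * d, s'.cpx (s.nat 14 + d * d + i) = (Polynomial.X * p).coeff i := by
  refine Run.mono (b := 2 + (d * d * 9 + 2)) ?_ (by omega) fun _ => id
  refine Run.seq (Run.block' 20 (by simp) (by simp [Instr.Unit]) (by simp [Instr.Above]) ?_)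
  intro s1 hs1 hf1
  have hc1 : s1.cpx = Function.update s.cpx (s.nat 14 + d * d) 0 := by
    rw [← hs1]
    simp [Instr.run, Store.setNat, Store.setCpx, NatOp.eval, CpxOp.eval, hr.r3]
  have hr1 := hr.congr fun r h => hf1 r (by omega)
  have key := Run.forLoop (s := s1) (i := 20) (y := 3) (b := 6)
    (body := block [.natOp .plus 21 13 3, .natOp .plus 21 21 20, .natOp .plus 22 14 10,
      .natOp .plus 22 22 20, .cpxOne 8, .cpxOp .times 22 21 8])
    (fun n c => (∀ a < s.nat 14 + d * d, c a = s.cpx a) ∧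
      ∀ i ≤ n, c (s.nat 14 + d * d + i) = (Polynomial.X * p).coeff i)
    (by norm_num) (by norm_num) ⟨fun a ha => by rw [hc1, Function.update_of_ne ha.ne],
      fun i hi => by obtain rfl : i = 0 := by omega
                     rw [hc1]; simp⟩ ?_
  · rw [hr1.r3] at key
    exact key.mono le_rfl fun s' h => ⟨fun r hr => by rw [h.1 r hr, hf1 r hr], h.2⟩
  · rintro y hy s2 hs2 hy2 ⟨hlo, hrow⟩
    rw [hr1.r3] at hy
    have hr2 := hr1.congr fun r h => hs2 r (by omega)
    have e6 : s2.nat 6 = s.nat 6 := by rw [hs2 _ (by norm_num), hf1 _ (by norm_num)]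
    have e13 : s2.nat 13 = s.nat 13 := by rw [hs2 _ (by norm_num), hf1 _ (by norm_num)]
    have e14 : s2.nat 14 = s.nat 14 := by rw [hs2 _ (by norm_num), hf1 _ (by norm_num)]
    refine Run.block' 21 (by simp) (by simp [Instr.Unit]) (by simp [Instr.Above]) ?_
    intro s3 hs3 hf3
    refine ⟨fun r h => hf3 r (by omega), ?_⟩
    -- Each coefficient is copied by multiplying it by 1.
    have hc3 : s3.cpx = Function.update (Function.update s2.cpx (s.nat 6 + 2) 1)
        (s.nat 14 + (d * d + 1) + y) (s2.cpx (s.nat 13 + d * d + y)) := by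
      have n1 := (show s.nat 13 + d * d + y < s.nat 6 + 2 by omega).ne
      rw [← hs3]
      simp [Instr.run, Store.setNat, Store.setCpx, NatOp.eval, CpxOp.eval, hr2.r8, hr2.r3, hr2.r10,
        e6, e13, e14, hy2, n1]
    rw [hc3]
    refine ⟨fun a ha => ?_, fun i hi => ?_⟩
    · rw [Function.update_of_ne (by omega), Function.update_of_ne (by omega), hlo a ha]
    · rcases hi.eq_or_lt with rfl | hlt
      · rw [show s.nat 14 + d * d + (y + 1) = s.nat 14 + (d * d + 1) + y by omega,
          Function.update_self, hlo _ (by omega), hp y hy.le, Polynomial.coeff_X_mul]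
      · rw [Function.update_of_ne (by omega), Function.update_of_ne (by omega),
          hrow i (by omega)]

/-- Appends row number `N[12] + 1`. -/
def krylovBody : Prog :=
  .seq (block [.natOp .times 13 12 5, .natOp .plus 13 4 13, .natOp .plus 14 13 5]) <|
  .seq applyProg <| .seq shiftProg <|
  .seq (block [.natConst 15 1, .natOp .plus 15 15 12]) (forLoop 16 15 orthBody)

theorem hsInner_zero_left (u : Matrix (Fin d) (Fin d) ℂ) : hsInner 0 u = 0 := by simp [hsInner]

theorem IsKrylovSequence.update {p : ℕ → Polynomial ℂ} {k : ℕ} (h : IsKrylovSequence T x p k)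
    (hm : q.Monic) (hn : q.natDegree = k + 1)
    (ho : ∀ i ≤ k, hsInner (Polynomial.aeval T (p i) x) (Polynomial.aeval T q x) = 0)
    (hs : Polynomial.aeval T (p k) x = 0 → q = Polynomial.X * p k) :
    IsKrylovSequence T x (Function.update p (k + 1) q) (k + 1) := by
  have hu : ∀ i ≤ k, Function.update p (k + 1) q i = p i := fun i hi =>
    Function.update_of_ne (by omega) _ _
  refine ⟨fun i hi => ?_, fun i hi => ?_, fun i j hij hj => ?_, fun i hi h0 => ?_⟩
  · rcases hi.eq_or_lt with rfl | hlt
    · rwa [Function.update_self]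
    · rw [hu i (by omega)]; exact h.monic i (by omega)
  · rcases hi.eq_or_lt with rfl | hlt
    · rwa [Function.update_self]
    · rw [hu i (by omega)]; exact h.natDegree i (by omega)
  · rw [hu i (by omega)]
    rcases hj.eq_or_lt with rfl | hlt
    · rw [Function.update_self]; exact ho i (by omega)
    · rw [hu j (by omega)]; exact h.orthogonal i j hij (by omega)
  · rw [hu i (by omega)] at h0 ⊢
    rcases (Nat.le_of_lt_succ hi).eq_or_lt with rfl | hlt
    · rw [Function.update_self]; exact hs h0
    · rw [hu (i + 1) (by omega)]; exact h.succ i hlt h0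

/-- Modified Gram-Schmidt: projections onto the rows 0, …, k are removed in turn from X `p k`. All
subtracted polynomials have degree at most k, so the result stays monic of degree k + 1. -/
theorem run_orthLoop {s : Store} (hr : Regs d m s) {p : ℕ → Polynomial ℂ} {k : ℕ}
    (hp : IsKrylovSequence T x p k) (h15 : s.nat 15 = k + 1)
    (hrows : ∀ i ≤ k, RowAt T x s.cpx (m * (d * d) + i * (2 * (d * d) + 1)) (p i))
    (h14 : s.nat 14 = m * (d * d) + (k + 1) * (2 * (d * d) + 1))
    (h6 : s.nat 14 + (2 * (d * d) + 1) ≤ s.nat 6)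
    (hw : RowAt T x s.cpx (s.nat 14) (Polynomial.X * p k)) :
    Run (forLoop 16 15 orthBody) s ((k + 1) * (d * d * 24 + 19) + 2) fun s' =>
      (∀ r < 16, s'.nat r = s.nat r) ∧ (∀ a < s.nat 14, s'.cpx a = s.cpx a) ∧
      ∃ q, RowAt T x s'.cpx (s.nat 14) q ∧
        IsKrylovSequence T x (Function.update p (k + 1) q) (k + 1) := by
  have hXk : (Polynomial.X * p k).natDegree = k + 1 := by
    rw [Polynomial.natDegree_X_mul (hp.monic k le_rfl).ne_zero, hp.natDegree k le_rfl]
  have key := Run.forLoop (s := s) (i := 16) (y := 15) (b := d * d * 24 + 16) (body := orthBody)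
    (fun n c => (∀ a < s.nat 14, c a = s.cpx a) ∧ ∃ q, RowAt T x c (s.nat 14) q ∧ q.Monic ∧
      q.natDegree = k + 1 ∧
      (∀ i < n, hsInner (Polynomial.aeval T (p i) x) (Polynomial.aeval T q x) = 0) ∧
      (Polynomial.aeval T (p k) x = 0 → q = Polynomial.X * p k))
    (by norm_num) (by norm_num)
    ⟨fun _ _ => rfl, _, hw, Polynomial.monic_X.mul (hp.monic k le_rfl), hXk, by simp,
      fun _ => rfl⟩ ?_
  · rw [h15] at key
    refine key.mono le_rfl fun s' h => ⟨h.1, h.2.1, ?_⟩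
    obtain ⟨q, hq, hm, hn, ho, hs⟩ := h.2.2
    exact ⟨q, hq, hp.update hm hn (fun i hi => ho i (by omega)) hs⟩
  · rintro j hj s1 hs1 hj1 ⟨hlo, q, hq, hm, hn, ho, hs⟩
    rw [h15] at hj
    have hr1 := hr.congr fun r h => hs1 r (by omega)
    have e6 := hs1 6 (by norm_num)
    have e14 := hs1 14 (by norm_num)
    have hmul := Nat.mul_le_mul_right (2 * (d * d) + 1) (Nat.succ_le_of_lt hj)
    rw [Nat.succ_mul] at hmul
    refine (run_orthBody hr1 hj1 ((hrows j (by omega)).congr (by omega) hlo) (by rwa [e14])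
      (by omega) (by omega)).mono le_rfl ?_
    rintro s2 ⟨hf2, hlo2, hrow2⟩
    rw [e14] at hlo2 hrow2
    refine ⟨hf2, fun a ha => by rw [hlo2 a ha, hlo a ha], _, hrow2, ?_, ?_, ?_, ?_⟩
    all_goals
      set β := hsInner (Polynomial.aeval T (p j) x) (Polynomial.aeval T q x) /
        hsInner (Polynomial.aeval T (p j) x) (Polynomial.aeval T (p j) x) with hβ
    · refine hm.sub_of_left (Polynomial.degree_lt_degree ?_)
      refine (Polynomial.natDegree_C_mul_le _ _).trans_lt ?_
      rw [hp.natDegree j (by omega), hn]; exact hj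
    · rw [Polynomial.natDegree_sub_eq_left_of_natDegree_lt, hn]
      refine (Polynomial.natDegree_C_mul_le _ _).trans_lt ?_
      rw [hp.natDegree j (by omega), hn]; exact hj
    · intro i hi
      have hev : Polynomial.aeval T (q - Polynomial.C β * p j) x =
          Polynomial.aeval T q x - β • Polynomial.aeval T (p j) x := by
        simp [Algebra.algebraMap_eq_smul_one]
      rw [hev, hsInner_sub, hsInner_smul]
      rcases (Nat.le_of_lt_succ hi).eq_or_lt with rfl | hlt
      -- A zero row makes the coefficient 0/0 = 0 and is orthogonal to everything; otherwise the
      -- projection cancels exactly.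
      · by_cases h0 : Polynomial.aeval T (p i) x = 0
        · rw [h0, hsInner_zero_left, hsInner_zero_left, mul_zero, sub_zero]
        · rw [hβ, div_mul_cancel₀ _ (mt hsInner_self_eq_zero.mp h0), sub_self]
      · rw [ho i hlt, hp.orthogonal i j hlt (by omega), mul_zero, sub_zero]
    -- If row k vanishes, the new vector is zero from the start, so every projection coefficient is
    -- 0 and X `p k` is left unchanged.
    · intro h0
      have hq0 : Polynomial.aeval T q x = 0 := by
        rw [hs h0, map_mul, Module.End.mul_apply, h0, map_zero]
      rw [hβ, hq0, hsInner_zero_right, zero_div, map_zero, zero_mul, sub_zero, hs h0]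

theorem run_krylovBody {K : Fin m → Matrix (Fin d) (Fin d) ℂ} {s : Store} (hr : Regs d m s)
    (hT : ∀ ρ, T ρ = ∑ k, K k * ρ * (K k)ᴴ) (hK : KrausAt s.cpx K)
    {p : ℕ → Polynomial ℂ} {k : ℕ} (hk : k < d * d) (h12 : s.nat 12 = k)
    (hp : IsKrylovSequence T x p k)
    (hrows : ∀ i ≤ k, RowAt T x s.cpx (m * (d * d) + i * (2 * (d * d) + 1)) (p i)) :
    Run krylovBody s
      (d * d * (m * (d * d) * 18 + 11) + d * d * 9 + d * d * (d * d * 24 + 19) + 13) fun s' =>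
      (∀ r ≤ 12, s'.nat r = s.nat r) ∧ KrausAt s'.cpx K ∧
      ∃ p' : ℕ → Polynomial ℂ, IsKrylovSequence T x p' (k + 1) ∧
        ∀ i ≤ k + 1, RowAt T x s'.cpx (m * (d * d) + i * (2 * (d * d) + 1)) (p' i) := by
  refine Run.mono (b := 3 + ((d * d * (m * (d * d) * 18 + 11) + 2) + ((d * d * 9 + 4) +
    (2 + ((k + 1) * (d * d * 24 + 19) + 2))))) ?_ ?_ fun _ => id
  swap
  · have := Nat.mul_le_mul_right (d * d * 24 + 19) (Nat.succ_le_of_lt hk)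
    rw [Nat.succ_eq_add_one] at this
    omega
  refine Run.seq (Run.block' 13 (by simp) (by simp [Instr.Unit]) (by simp [Instr.Above]) ?_)
  intro s1 hs1 hf1
  have hr1 := hr.congr fun r h => hf1 r (by omega)
  have e13 : s1.nat 13 = m * (d * d) + k * (2 * (d * d) + 1) := by
    rw [← hs1]; simp [Instr.run, Store.setNat, NatOp.eval, h12, hr.r4, hr.r5]
  have e14 : s1.nat 14 = m * (d * d) + (k + 1) * (2 * (d * d) + 1) := by
    rw [← hs1, Nat.succ_mul]
    simp [Instr.run, Store.setNat, NatOp.eval, h12, hr.r4, hr.r5, add_assoc]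
  have hc1 : s1.cpx = s.cpx := by
    rw [← hs1]; simp [Instr.run, Store.setNat]
  clear hs1
  -- The scratch area starts after room for d² + 2 rows, one more than the rows 0, …, d² require.
  have hle : s1.nat 14 + (2 * (d * d) + 1) ≤ s1.nat 6 := by
    have := Nat.mul_le_mul_right (2 * (d * d) + 1) (show k + 2 ≤ d * d + 2 by omega)
    rw [e14, hr1.r6, add_assoc, ← Nat.succ_mul]
    exact Nat.add_le_add_left this _
  have hsucc := Nat.succ_mul k (2 * (d * d) + 1)
  rw [Nat.succ_eq_add_one] at hsucc
  refine Run.seq ((run_applyProg hr1 (hc1 ▸ hK) (e13 ▸ hc1 ▸ (hrows k le_rfl).1) (by omega)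
    (by omega) (by omega)).mono le_rfl ?_)
  rintro s2 ⟨hf2, hlo2, hM2⟩
  have hr2 := hr1.congr fun r h => hf2 r (by omega)
  have f6 := hf2 6 (by norm_num)
  have f13 := hf2 13 (by norm_num)
  have f14 := hf2 14 (by norm_num)
  refine Run.seq ((run_shiftProg hr2 (p := p k) (fun i hi => ?_) (by omega) (by omega)).mono
    le_rfl ?_)
  · rw [hlo2 _ (by omega), f13, e13, hc1, (hrows k le_rfl).2 i hi]
  rintro s3 ⟨hf3, hlo3, hP3⟩
  have hr3 := hr2.congr fun r h => hf3 r (by omega)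
  refine Run.seq (Run.block' 15 (by simp) (by simp [Instr.Unit]) (by simp [Instr.Above]) ?_)
  intro s4 hs4 hf4
  have e15 : s4.nat 15 = k + 1 := by
    have : s3.nat 12 = k := by
      rw [hf3 _ (by norm_num), hf2 _ (by norm_num), hf1 _ (by norm_num), h12]
    rw [← hs4]; simp [Instr.run, Store.setNat, NatOp.eval, this, add_comm]
  have hc4 : s4.cpx = s3.cpx := by
    rw [← hs4]; simp [Instr.run, Store.setNat]
  have hr4 := hr3.congr fun r h => hf4 r (by omega)
  have g14 : s4.nat 14 = m * (d * d) + (k + 1) * (2 * (d * d) + 1) := by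
    rw [hf4 _ (by norm_num), hf3 _ (by norm_num), f14, e14]
  have g6 : s4.nat 6 = s1.nat 6 := by
    rw [hf4 _ (by norm_num), hf3 _ (by norm_num), f6]
  have hlo4 : ∀ a < m * (d * d) + (k + 1) * (2 * (d * d) + 1), s4.cpx a = s.cpx a :=
    fun a ha => by rw [hc4, hlo3 a (by omega), hlo2 a (by omega), hc1]
  have hrow_le : ∀ i ≤ k, m * (d * d) + i * (2 * (d * d) + 1) + (2 * (d * d) + 1) ≤
      m * (d * d) + (k + 1) * (2 * (d * d) + 1) := fun i hi => by
    have := Nat.mul_le_mul_right (2 * (d * d) + 1) (Nat.succ_le_succ hi)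
    rw [Nat.succ_mul, Nat.succ_eq_add_one] at this
    omega
  refine (run_orthLoop hr4 hp e15 (fun i hi => (hrows i hi).congr (hrow_le i hi) hlo4) g14
    (by omega) ⟨?_, fun i hi => ?_⟩).mono le_rfl ?_
  -- T(p(T)x) = (Xp)(T)x, so the output of the super-operator matches the shifted coefficients.
  · rw [map_mul, Module.End.mul_apply, Polynomial.aeval_X, hT, g14, ← e14, hc4]
    exact hM2.congr (b := s1.nat 14 + d * d) le_rfl fun a ha => hlo3 a (by omega)
  · rw [hc4, g14, ← e14, ← f14, hP3 i hi]
  · rintro s5 ⟨hf5, hlo5, q, hq, hseq⟩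
    rw [g14] at hlo5 hq
    have hlo5' : ∀ a < m * (d * d) + (k + 1) * (2 * (d * d) + 1), s5.cpx a = s.cpx a :=
      fun a ha => by rw [hlo5 a ha, hlo4 a ha]
    refine ⟨fun r h => ?_, hK.congr (Nat.le_add_right _ _) hlo5', _, hseq, fun i hi => ?_⟩
    · rw [hf5 r (by omega), hf4 r (by omega), hf3 r (by omega), hf2 r (by omega), hf1 r (by omega)]
    · rcases hi.eq_or_lt with rfl | hlt
      · rwa [Function.update_self]
      · rw [Function.update_of_ne (by omega)]
        exact (hrows i (by omega)).congr (hrow_le i (by omega)) hlo5'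

end Rows

/-! ### Root extraction, deflation and orders of roots of unity. -/

section Roots

theorem someRoot_isRoot {p : Polynomial ℂ} (hp : 0 < p.natDegree) : p.IsRoot (someRoot p) :=
  Classical.epsilon_spec (Complex.exists_root (Polynomial.natDegree_pos_iff_degree_pos.mp hp))

theorem Store.poly_eq {s : Store} {b k : ℕ} {p : Polynomial ℂ} (hp : p.natDegree = k)
    (h : ∀ i ≤ k, s.cpx (b + i) = p.coeff i) : s.poly b k = p := by
  rw [Store.poly, p.as_sum_range_C_mul_X_pow, hp]
  exact Finset.sum_congr rfl fun i hi => by rw [h i (by simpa [Nat.lt_succ_iff] using hi)]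

/-- This is the recursion of synthetic division, used from the top coefficient downwards. -/
theorem coeff_X_sub_C_mul_succ (z : ℂ) (q : Polynomial ℂ) (i : ℕ) :
    q.coeff i = ((Polynomial.X - Polynomial.C z) * q).coeff (i + 1) + z * q.coeff (i + 1) := by
  simp [sub_mul]

/-- Divides the polynomial of degree `N[15]` at `N[14]` by `X - Z[N[6]]`. -/
def deflateProg : Prog := forLoop 20 15 <| block
  [.natOp .minus 21 15 20, .natOp .plus 22 14 21, .natConst 23 1, .natOp .minus 23 22 23,
    .cpxOp .times 7 6 22, .cpxOp .plus 23 23 7]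

variable {d m : ℕ}

/-- The division is done in place. The leading coefficient of p is also that of q, so q ends up one
cell higher than p; the cell at `N[14]` is left with the remainder and is no longer used. -/
theorem run_deflateProg {s : Store} (hr : Regs d m s) {p q : Polynomial ℂ} {k : ℕ} {z : ℂ}
    (hk : s.nat 15 = k) (hz : s.cpx (s.nat 6) = z)
    (hp : p = (Polynomial.X - Polynomial.C z) * q) (hm : p.Monic) (hn : p.natDegree = k)
    (hc : ∀ i ≤ k, s.cpx (s.nat 14 + i) = p.coeff i) (h1 : s.nat 14 + k < s.nat 6) :
    Run deflateProg s (k * 9 + 2) fun s' => (∀ r < 20, s'.nat r = s.nat r) ∧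
      ∀ i < k, s'.cpx (s.nat 14 + 1 + i) = q.coeff i := by
  have hcoeff : ∀ i, q.coeff i = p.coeff (i + 1) + z * q.coeff (i + 1) := fun i => by
    rw [hp]; exact coeff_X_sub_C_mul_succ z q i
  have hqn : k = 1 + q.natDegree := by
    have hq0 : q ≠ 0 := by
      rintro rfl; rw [mul_zero] at hp; exact hm.ne_zero hp
    rw [← hn, hp, Polynomial.natDegree_mul (Polynomial.X_sub_C_ne_zero z) hq0,
      Polynomial.natDegree_X_sub_C]
  have key := Run.forLoop (s := s) (i := 20) (y := 15) (b := 6)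
    (body := block [.natOp .minus 21 15 20, .natOp .plus 22 14 21, .natConst 23 1,
      .natOp .minus 23 22 23, .cpxOp .times 7 6 22, .cpxOp .plus 23 23 7])
    (fun n c => c (s.nat 6) = z ∧ ∀ i ≤ k, (k - n ≤ i → 1 ≤ i →
      c (s.nat 14 + i) = q.coeff (i - 1)) ∧ (i < k - n → c (s.nat 14 + i) = p.coeff i))
    (by norm_num) (by norm_num)
    ⟨hz, fun i hi => ⟨fun h h' => ?_, fun _ => hc i hi⟩⟩ ?_
  · rw [hk] at key
    refine key.mono le_rfl fun s' h => ⟨h.1, fun i hi => ?_⟩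
    have := (h.2.2 (i + 1) (by omega)).1 (by omega) (by omega)
    rwa [Nat.add_sub_cancel, add_comm i 1, ← add_assoc] at this
  · obtain rfl : i = k := by omega
    obtain ⟨j, rfl⟩ := Nat.exists_eq_add_of_le' h'
    rw [Nat.add_sub_cancel, hc _ le_rfl, hcoeff j, Polynomial.coeff_eq_zero_of_natDegree_lt
      (p := q) (by omega), mul_zero, add_zero]
  · rintro n hnk s1 hs1 hn1 ⟨hz1, hI⟩
    rw [hk] at hnk
    have hr1 := hr.congr fun r h => hs1 r (by omega)
    have e6 := hs1 6 (by norm_num)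
    have e14 := hs1 14 (by norm_num)
    have e15 := hs1 15 (by norm_num)
    refine Run.block' 21 (by simp) (by simp [Instr.Unit]) (by simp [Instr.Above]) ?_
    intro s2 hs2 hf2
    refine ⟨fun r h => hf2 r (by omega), ?_⟩
    obtain ⟨j, hj⟩ : ∃ j, k - n = j + 1 := ⟨k - n - 1, by omega⟩
    have hc2 : s2.cpx = Function.update (Function.update s1.cpx (s.nat 6 + 1)
        (z * q.coeff j)) (s.nat 14 + j) (p.coeff j + z * q.coeff j) := by
      have n1 := (show s.nat 14 + j < s.nat 6 + 1 by omega).ne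
      have g1 := (hI (j + 1) (by omega)).1 (by omega) (by omega)
      have g2 := (hI j (by omega)).2 (by omega)
      rw [Nat.add_sub_cancel] at g1
      have n2 : s.nat 14 + (j + 1) - 1 = s.nat 14 + j := by omega
      rw [← g1, ← g2, ← hs2]
      simp [Instr.run, Store.setNat, Store.setCpx, NatOp.eval, CpxOp.eval, hr1.r7, e6, e14, e15,
        hk, hn1, hj, n1, n2, hz1]
    rw [hc2]
    refine ⟨?_, fun i hi => ⟨fun h h' => ?_, fun h => ?_⟩⟩
    · rw [Function.update_of_ne (by omega), Function.update_of_ne (by omega), hz1]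
    · rcases eq_or_ne i j with rfl | hne
      · obtain ⟨l, rfl⟩ := Nat.exists_eq_add_of_le' h'
        rw [Function.update_self, Nat.add_sub_cancel, ← hcoeff l]
      · rw [Function.update_of_ne (by omega), Function.update_of_ne (by omega),
          (hI i hi).1 (by omega) h']
    · rw [Function.update_of_ne (by omega), Function.update_of_ne (by omega),
        (hI i hi).2 (by omega)]

/-- Splits off a root of the polynomial of degree `N[3] - N[13]` at `N[12] + N[13]` and accounts for
its order in `N[11]`, if it lies on the unit circle. -/
def rootBody : Prog :=
  .seq (block [.natOp .plus 14 12 13, .natOp .minus 15 3 13]) <|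
  .seq (.instr (.cpxRoot 6 14 15)) <|
  .seq (block [.cpxConj 7 6, .cpxOp .times 7 7 6, .cpxOne 8]) <|
  .seq (.ifte (.cpxEq 7 8) (block [.rootOrder 16 6, .natOp .times 17 11 16, .natOp .gcd 18 11 16,
    .natOp .quot 11 17 18]) .skip) deflateProg

theorem conj_mul_self_eq_one_iff {z : ℂ} : starRingEnd ℂ z * z = 1 ↔ ‖z‖ = 1 := by
  rw [Complex.conj_mul']
  norm_cast
  exact pow_eq_one_iff_of_nonneg (norm_nonneg z) two_ne_zero

/-- `N[11]` is replaced by its lcm with the order of a unimodular root. Order 0, for a number that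
is not a root of unity, makes the lcm 0 for good, in agreement with the fact that only θ = 0 then
satisfies the condition. -/
theorem run_rootBody {s : Store} (hr : Regs d m s) {p : Polynomial ℂ} {n : ℕ} {M : Multiset ℂ}
    (hn : n < d * d) (h13 : s.nat 13 = n) (h12 : s.nat 12 + d * d < s.nat 6) (hm : p.Monic)
    (hdeg : p.natDegree = d * d - n)
    (hc : ∀ i ≤ d * d - n, s.cpx (s.nat 12 + n + i) = p.coeff i)
    (hL : ∀ θ, s.nat 11 ∣ θ ↔ ∀ z ∈ M, ‖z‖ = 1 → z ^ θ = 1) :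
    Run rootBody s (d * d * 10 + 13) fun s' => (∀ r ≤ 13, r ≠ 11 → s'.nat r = s.nat r) ∧
      ∃ z q, p = (Polynomial.X - Polynomial.C z) * q ∧ q.Monic ∧ q.natDegree = d * d - (n + 1) ∧
        (∀ i ≤ d * d - (n + 1), s'.cpx (s.nat 12 + (n + 1) + i) = q.coeff i) ∧
        ∀ θ, s'.nat 11 ∣ θ ↔ ∀ w ∈ z ::ₘ M, ‖w‖ = 1 → w ^ θ = 1 := by
  refine Run.mono (b := 2 + ((d * d + 1) + (3 + ((4 + 1) + ((d * d - n) * 9 + 2))))) ?_ (by omega)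
    fun _ => id
  refine Run.seq (Run.block' 14 (by simp) (by simp [Instr.Unit]) (by simp [Instr.Above]) ?_)
  intro s1 hs1 hf1
  have e14 : s1.nat 14 = s.nat 12 + n := by
    rw [← hs1]; simp [Instr.run, Store.setNat, NatOp.eval, h13]
  have e15 : s1.nat 15 = d * d - n := by
    rw [← hs1]; simp [Instr.run, Store.setNat, NatOp.eval, h13, hr.r3]
  have hc1 : s1.cpx = s.cpx := by
    rw [← hs1]; simp [Instr.run, Store.setNat]
  clear hs1
  have hr6 := hf1 6 (by norm_num)
  have hr7 := (hf1 7 (by norm_num)).trans hr.r7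
  have hr8 := (hf1 8 (by norm_num)).trans hr.r8
  refine Run.seq (Run.instr (by simp only [Instr.cost]; omega) ?_)
  have hpoly : s1.poly (s1.nat 14) (s1.nat 15) = p := by
    rw [e14, e15]
    exact Store.poly_eq hdeg (by rwa [hc1])
  set z := someRoot p with hz
  have hroot : p.IsRoot z := someRoot_isRoot (by omega)
  obtain ⟨q, hq⟩ := Polynomial.dvd_iff_isRoot.mpr hroot
  have hqm : q.Monic := (Polynomial.monic_X_sub_C z).of_mul_monic_left (hq ▸ hm)
  have hqn : q.natDegree = d * d - (n + 1) := by
    rw [hq, (Polynomial.monic_X_sub_C z).natDegree_mul hqm, Polynomial.natDegree_X_sub_C] at hdeg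
    omega
  obtain ⟨s2, hs2⟩ : ∃ s2, s2 = Instr.run (.cpxRoot 6 14 15) s1 := ⟨_, rfl⟩
  have hn2 : s2.nat = s1.nat := by rw [hs2]; rfl
  have hc2 : s2.cpx = Function.update s.cpx (s.nat 6) z := by
    rw [hs2]; simp only [Instr.run, Store.setCpx]; rw [hpoly, hc1, hr6]
  rw [← hs2]
  refine Run.seq (Run.block' 14 (by simp) (by simp [Instr.Unit]) (by simp [Instr.Above]) ?_)
  intro s3 hs3 _
  have hn3 : s3.nat = s1.nat := by rw [← hs3, ← hn2]; rfl
  have hc3 : s3.cpx = Function.update (Function.update s2.cpx (s.nat 6 + 1)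
      (starRingEnd ℂ z * z)) (s.nat 6 + 2) 1 := by
    have : s2.cpx (s.nat 6) = z := by rw [hc2, Function.update_self]
    rw [← hs3]
    simp [Instr.run, Store.setCpx, CpxOp.eval, hn2, hr6, hr7, hr8, this]
  have hz3 : s3.cpx (s.nat 6) = z := by
    rw [hc3, Function.update_of_ne (by omega), Function.update_of_ne (by omega), hc2,
      Function.update_self]
  have hlo3 : ∀ a < s.nat 6, s3.cpx a = s.cpx a := fun a ha => by
    rw [hc3, Function.update_of_ne (by omega), Function.update_of_ne (by omega), hc2,
      Function.update_of_ne ha.ne]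
  have htest : (Test.cpxEq 7 8).Holds s3 ↔ ‖z‖ = 1 := by
    simp only [Test.Holds]
    rw [hn3, hr7, hr8, hc3, Function.update_self, Function.update_of_ne (by omega),
      Function.update_self, conj_mul_self_eq_one_iff]
  have hL3 : s3.nat 11 = s.nat 11 := by rw [hn3, hf1 _ (by norm_num)]
  have hif : Run (.ifte (.cpxEq 7 8) (block [.rootOrder 16 6, .natOp .times 17 11 16,
      .natOp .gcd 18 11 16, .natOp .quot 11 17 18]) .skip) s3 (4 + 1) fun s4 =>
      (∀ r < 16, r ≠ 11 → s4.nat r = s3.nat r) ∧ s4.cpx = s3.cpx ∧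
      ∀ θ, s4.nat 11 ∣ θ ↔ ∀ w ∈ z ::ₘ M, ‖w‖ = 1 → w ^ θ = 1 := by
    refine Run.ifte (fun ht => ?_) fun ht => (Run.skip ?_).mono (Nat.zero_le _) fun _ => id
    · rw [htest] at ht
      refine Run.block (by simp) (by simp [Instr.Unit]) ⟨fun r h h' => ?_, ?_, fun θ => ?_⟩
      · simp [Instr.run, Store.setNat, h', h.ne, show r ≠ 17 by omega, show r ≠ 18 by omega]
      · simp [Instr.run, Store.setNat]
      · have hlcm : (List.foldl (fun s i => Instr.run i s) s3 [.rootOrder 16 6,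
            .natOp .times 17 11 16, .natOp .gcd 18 11 16, .natOp .quot 11 17 18]).nat 11 =
            Nat.lcm (s.nat 11) (orderOf z) := by
          rw [← hz3, ← hL3]
          simp [Instr.run, Store.setNat, NatOp.eval, Nat.lcm, hn3, hr6]
        rw [hlcm, Nat.lcm_dvd_iff, hL, orderOf_dvd_iff_pow_eq_one, Multiset.forall_mem_cons]
        exact ⟨fun h => ⟨fun _ => h.2, h.1⟩, fun h => ⟨h.2, h.1 ht⟩⟩
    · rw [htest] at ht
      refine ⟨fun _ _ _ => rfl, rfl, fun θ => ?_⟩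
      rw [hL3, hL, Multiset.forall_mem_cons]
      exact ⟨fun h => ⟨fun h' => absurd h' ht, h⟩, fun h => h.2⟩
  refine Run.seq (hif.mono le_rfl ?_)
  rintro s4 ⟨hf4, hc4, hL4⟩
  have hf4' : ∀ r ≤ 13, r ≠ 11 → s4.nat r = s.nat r := fun r h h' => by
    rw [hf4 r (by omega) h', hn3, hf1 r (by omega)]
  have hr4 : Regs d m s4 := hr.congr fun r h => hf4' r (by omega) (by omega)
  have f14 : s4.nat 14 = s.nat 12 + n := by rw [hf4 _ (by norm_num) (by norm_num), hn3, e14]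
  have f15 : s4.nat 15 = d * d - n := by rw [hf4 _ (by norm_num) (by norm_num), hn3, e15]
  have f6 := hf4' 6 (by norm_num) (by norm_num)
  refine (run_deflateProg hr4 f15 (by rw [f6, hc4, hz3]) hq hm hdeg (fun i hi => ?_)
    (by omega)).mono le_rfl ?_
  · rw [f14, hc4, hlo3 _ (by omega), hc i hi]
  · rintro s5 ⟨hf5, hc5⟩
    refine ⟨fun r h h' => by rw [hf5 r (by omega), hf4' r h h'], z, q, hq, hqm, hqn,
      fun i hi => ?_, ?_⟩
    · rcases Nat.lt_or_ge i (d * d - n) with hlt | hge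
      · rw [← hc5 i hlt, f14, ← add_assoc (s.nat 12) n 1]
      · omega
    · rw [hf5 _ (by norm_num)]; exact hL4

theorem run_rootLoop {s : Store} (hr : Regs d m s) {p : Polynomial ℂ}
    (h12 : s.nat 12 + d * d < s.nat 6) (hm : p.Monic) (hdeg : p.natDegree = d * d)
    (hc : ∀ i ≤ d * d, s.cpx (s.nat 12 + i) = p.coeff i) (h11 : s.nat 11 = 1) :
    Run (forLoop 13 3 rootBody) s (d * d * (d * d * 10 + 16) + 2) fun s' => ∃ M : Multiset ℂ,
      p = (M.map fun z => Polynomial.X - Polynomial.C z).prod ∧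
      ∀ θ, s'.nat 11 ∣ θ ↔ ∀ z ∈ M, ‖z‖ = 1 → z ^ θ = 1 := by
  -- The general loop rule is needed because `N[11]`, below the counter, changes. The n-th quotient
  -- starts at `N[12] + n`, as each deflation moves it up by one cell.
  refine Run.forLoop_general (b := d * d * 10 + 13) (fun n s' =>
    (∀ r < 13, r ≠ 11 → s'.nat r = s.nat r) ∧ ∃ (M : Multiset ℂ) (q : Polynomial ℂ),
      p = (M.map fun z => Polynomial.X - Polynomial.C z).prod * q ∧ q.Monic ∧
      q.natDegree = d * d - n ∧ (∀ i ≤ d * d - n, s'.cpx (s.nat 12 + n + i) = q.coeff i) ∧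
      ∀ θ, s'.nat 11 ∣ θ ↔ ∀ z ∈ M, ‖z‖ = 1 → z ^ θ = 1) (by norm_num) ?_ ?_ ?_ ?_ ?_
  · rintro n s' v w ⟨h1, M, q, h2, h3, h4, h5, h6⟩
    refine ⟨fun r hr h' => ?_, M, q, h2, h3, h4, h5, ?_⟩
    · rw [← h1 r hr h']
      simp [Store.setNat, hr.ne, show r ≠ 99 by omega]
    · simpa [Store.setNat] using h6
  · exact ⟨fun _ _ _ => rfl, 0, p, by simp, hm, hdeg, hc, by simp [h11]⟩
  · rintro n s' ⟨h1, -⟩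
    rw [h1 3 (by norm_num) (by norm_num), hr.r3]
  · rintro n hn s1 hn1 ⟨hf1, M, q, hp, hqm, hqn, hqc, hL⟩
    have hr1 : Regs d m s1 := hr.congr fun r h => hf1 r (by omega) (by omega)
    have e12 := hf1 12 (by norm_num) (by norm_num)
    have e6 := hf1 6 (by norm_num) (by norm_num)
    refine (run_rootBody hr1 hn hn1 (by rwa [e12, e6]) hqm hqn (by rwa [e12]) hL).mono le_rfl ?_
    rintro s2 ⟨hf2, z, q', hq', hm', hn', hc', hL'⟩
    refine ⟨(hf2 13 le_rfl (by norm_num)).trans hn1,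
      fun r h h' => (hf2 r h.le h').trans (hf1 r h h'), z ::ₘ M, q', ?_, hm', hn', ?_, hL'⟩
    · rw [hp, hq', Multiset.map_cons, Multiset.prod_cons]; ring
    · rwa [e12] at hc'
  · rintro s' ⟨-, M, q, hp, hqm, hqn, -, hL⟩
    refine ⟨M, ?_, hL⟩
    rw [hp, hqm.natDegree_eq_zero.mp (by omega), mul_one]

end Roots

/-! ### The complete program and its running time. -/

section Main

/-- Initializes the registers. -/
def setupProg : Prog := block
  [.natConst 2 1, .natOp .times 3 0 0, .natOp .times 4 1 3, .natOp .plus 10 3 2,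
    .natOp .plus 5 3 10, .natOp .plus 6 10 2, .natOp .times 6 6 5, .natOp .plus 6 6 4,
    .natOp .plus 7 6 2, .natOp .plus 8 7 2, .natOp .plus 9 8 2, .natConst 11 1]

/-- Appends the coefficients of the constant polynomial `1` to the initial state. -/
def firstRowProg : Prog :=
  .seq (forLoop 12 10 (block [.natOp .plus 13 4 3, .natOp .plus 13 13 12,
    .cpxOp .minus 13 13 13])) (block [.natOp .plus 13 4 3, .cpxOne 13])

/-- Computes in `N[11]` the period of a quantum Markov chain, or `0` if the chain is not
periodically stable. -/
def periodProg : Prog :=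
  .seq setupProg <| .seq firstRowProg <| .seq (forLoop 12 3 krylovBody) <|
  .seq (block [.natOp .times 12 3 5, .natOp .plus 12 4 12, .natOp .plus 12 12 3])
    (forLoop 13 3 rootBody)

variable {d m : ℕ} {K : Fin m → Matrix (Fin d) (Fin d) ℂ} {ρ : Matrix (Fin d) (Fin d) ℂ}

theorem run_setupProg {s : Store} (h : s.HoldsInput K ρ) :
    Run setupProg s 12 fun s' => Regs d m s' ∧ s'.nat 11 = 1 ∧ s'.cpx = s.cpx := by
  refine Run.block (by simp) (by simp [Instr.Unit]) ⟨?_, ?_, ?_⟩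
  · constructor <;> simp [Instr.run, Store.setNat, NatOp.eval, h.1, h.2.1] <;> ring
  · simp [Instr.run, Store.setNat]
  · simp [Instr.run, Store.setNat]

/-- In the input, ρ₀ already stands where row 0 begins, so only the coefficients of the polynomial 1
have to be written. -/
theorem run_firstRowProg {s : Store} (hr : Regs d m s) (hK : KrausAt s.cpx K)
    (hρ : MatAt s.cpx (m * (d * d)) ρ) (T : Module.End ℂ (Matrix (Fin d) (Fin d) ℂ)) :
    Run firstRowProg s ((d * d + 1) * 6 + 4) fun s' => (∀ r < 12, s'.nat r = s.nat r) ∧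
      KrausAt s'.cpx K ∧ RowAt T ρ s'.cpx (m * (d * d)) 1 := by
  have key := Run.forLoop (s := s) (i := 12) (y := 10) (b := 3)
    (body := block [.natOp .plus 13 4 3, .natOp .plus 13 13 12, .cpxOp .minus 13 13 13])
    (fun n c => (∀ a < m * (d * d) + d * d, c a = s.cpx a) ∧
      ∀ i < n, c (m * (d * d) + d * d + i) = 0) (by norm_num) (by norm_num)
    ⟨fun _ _ => rfl, by simp⟩ ?_
  · rw [hr.r10] at key
    refine Run.mono (b := ((d * d + 1) * 6 + 2) + 2) ?_ le_rfl fun _ => id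
    refine Run.seq (key.mono le_rfl ?_)
    rintro s1 ⟨hf1, hlo1, hz1⟩
    have hr1 := hr.congr fun r h => hf1 r (by omega)
    refine Run.block' 13 (by simp) (by simp [Instr.Unit]) (by simp [Instr.Above]) ?_
    intro s2 hs2 hf2
    have hc2 : s2.cpx = Function.update s1.cpx (m * (d * d) + d * d) 1 := by
      rw [← hs2]; simp [Instr.run, Store.setNat, Store.setCpx, NatOp.eval, hr1.r4, hr1.r3]
    have hlo2 : ∀ a < m * (d * d) + d * d, s2.cpx a = s.cpx a := fun a ha => by
      rw [hc2, Function.update_of_ne ha.ne, hlo1 a ha]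
    refine ⟨fun r h => by rw [hf2 r (by omega), hf1 r h], hK.congr (Nat.le_add_right _ _) hlo2,
      ?_, fun i hi => ?_⟩
    · simpa using hρ.congr le_rfl hlo2
    · rw [hc2, Polynomial.coeff_one]
      rcases Nat.eq_zero_or_pos i with rfl | hpos
      · simp
      · rw [Function.update_of_ne (by omega), hz1 i (by omega), if_neg hpos.ne']
  · rintro n hn s1 hs1 hn1 ⟨hlo, hz⟩
    have hr1 := hr.congr fun r h => hs1 r (by omega)
    refine Run.block' 13 (by simp) (by simp [Instr.Unit]) (by simp [Instr.Above]) ?_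
    intro s2 hs2 hf2
    refine ⟨fun r h => hf2 r (by omega), ?_⟩
    have hc2 : s2.cpx = Function.update s1.cpx (m * (d * d) + d * d + n) 0 := by
      rw [← hs2]
      simp [Instr.run, Store.setNat, Store.setCpx, NatOp.eval, CpxOp.eval, hr1.r4, hr1.r3, hn1]
    rw [hc2]
    refine ⟨fun a ha => ?_, fun i hi => ?_⟩
    · rw [Function.update_of_ne (by omega), hlo a ha]
    · rcases (Nat.le_of_lt_succ hi).eq_or_lt with rfl | hlt
      · rw [Function.update_self]
      · rw [Function.update_of_ne (by omega), hz i hlt]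

theorem run_krylovLoop {s : Store} (hr : Regs d m s) {T : Module.End ℂ (Matrix (Fin d) (Fin d) ℂ)}
    (hT : ∀ u, T u = ∑ k, K k * u * (K k)ᴴ) (hK : KrausAt s.cpx K)
    (hρ : RowAt T ρ s.cpx (m * (d * d)) 1) :
    Run (forLoop 12 3 krylovBody) s (d * d * (d * d * (m * (d * d) * 18 + 11) + d * d * 9 +
      d * d * (d * d * 24 + 19) + 16) + 2) fun s' => (∀ r < 12, s'.nat r = s.nat r) ∧
      ∃ p : ℕ → Polynomial ℂ, IsKrylovSequence T ρ p (d * d) ∧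
        RowAt T ρ s'.cpx (m * (d * d) + d * d * (2 * (d * d) + 1)) (p (d * d)) := by
  have key := Run.forLoop (s := s) (i := 12) (y := 3) (body := krylovBody)
    (b := d * d * (m * (d * d) * 18 + 11) + d * d * 9 + d * d * (d * d * 24 + 19) + 13)
    (fun n c => KrausAt c K ∧ ∃ p : ℕ → Polynomial ℂ, IsKrylovSequence T ρ p n ∧
      ∀ i ≤ n, RowAt T ρ c (m * (d * d) + i * (2 * (d * d) + 1)) (p i)) (by norm_num) (by norm_num)
    ⟨hK, fun _ => 1, ⟨fun _ _ => Polynomial.monic_one, fun k hk => ?_, fun i j h h' => ?_,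
      fun k hk => ?_⟩, fun i hi => ?_⟩ ?_
  · rw [hr.r3] at key
    refine key.mono le_rfl ?_
    rintro s' ⟨hf, -, p, hp, hrows⟩
    exact ⟨hf, p, hp, hrows _ le_rfl⟩
  · rw [Polynomial.natDegree_one]; omega
  · omega
  · omega
  · obtain rfl : i = 0 := by omega
    simpa using hρ
  · rintro n hn s1 hs1 hn1 ⟨hK1, p, hp, hrows⟩
    rw [hr.r3] at hn
    exact run_krylovBody (hr.congr fun r h => hs1 r (by omega)) hT hK1 hn hn1 hp hrows

/-- Here n stands for d². The dominant term is n applications of n entries with m n ≤ n² summands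
each, that is 18 n⁴. -/
theorem time_le {n : ℕ} (hn : 1 ≤ n) (hm : m ≤ n) :
    12 + (((n + 1) * 6 + 4) + ((n * (n * (m * n * 18 + 11) + n * 9 + n * (n * 24 + 19) + 16) + 2) +
      (3 + (n * (n * 10 + 16) + 2)))) + 3 ≤ 200 * n ^ 4 := by
  have h1 : n * (n * (m * n * 18)) ≤ n * (n * (n * n * 18)) := by gcongr
  have e1 : 1 ≤ n ^ 4 := Nat.one_le_pow _ _ hn
  have e2 : n ≤ n ^ 4 := by simpa using Nat.pow_le_pow_right hn (show 1 ≤ 4 by norm_num)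
  have e3 : n ^ 2 ≤ n ^ 4 := Nat.pow_le_pow_right hn (by norm_num)
  have e4 : n ^ 3 ≤ n ^ 4 := Nat.pow_le_pow_right hn (by norm_num)
  nlinarith

/-- The program computes a number `L` such that convergence along `θ > 0` means `L ∣ θ`. -/
theorem run_periodProg (G : Chain d) (hm : m ≤ d ^ 2) (hK : IsKraus G.superOp K) {s : Store}
    (hs : s.HoldsInput K G.init) {l : List Instr} (hl : l.length ≤ 3) (hu : ∀ i ∈ l, i.Unit)
    {f : ℕ → ℕ} (hf : ∀ s : Store, (l.foldl (fun s i => i.run s) s).nat 0 = f (s.nat 11)) :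
    Run (.seq periodProg (block l)) s (200 * d ^ 8) fun s' =>
      ∃ L, s'.nat 0 = f L ∧ ∀ θ, 0 < θ → (G.ConvergesAlong θ ↔ L ∣ θ) := by
  -- In dimension 0 no matrix has trace 1. Positivity matters because the time bound would otherwise
  -- be 0.
  have hd : 0 < d := by
    rcases Nat.eq_zero_or_pos d with rfl | h
    · have := G.init_isState.2
      simp [Matrix.trace] at this
    · exact h
  have hK0 : KrausAt s.cpx K := fun k i j => by
    rw [← hs.2.2.1 k i j, ← add_assoc, sq]
  have hρ0 : MatAt s.cpx (m * (d * d)) G.init := fun i j => by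
    rw [← hs.2.2.2 i j, ← add_assoc, sq]
  refine Run.mono (b := 12 + (((d * d + 1) * 6 + 4) + ((d * d * (d * d * (m * (d * d) * 18 + 11) +
    d * d * 9 + d * d * (d * d * 24 + 19) + 16) + 2) + (3 + (d * d * (d * d * 10 + 16) + 2)))) + 3)
    ?_ ((time_le (Nat.mul_pos hd hd) (by rwa [sq] at hm)).trans_eq (by ring)) fun _ => id
  refine Run.seq (Run.seq ((run_setupProg hs).mono le_rfl ?_))
  rintro s1 ⟨hr1, h11, hc1⟩
  rw [← hc1] at hK0 hρ0
  refine Run.seq ((run_firstRowProg hr1 hK0 hρ0 G.superOp).mono le_rfl ?_)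
  rintro s2 ⟨hf2, hK2, hρ2⟩
  have hr2 := hr1.congr fun r h => hf2 r (by omega)
  refine Run.seq ((run_krylovLoop hr2 hK.1 hK2 hρ2).mono le_rfl ?_)
  rintro s3 ⟨hf3, p, hp, hrow⟩
  have hr3 := hr2.congr fun r h => hf3 r (by omega)
  refine Run.seq (Run.block' 12 (by simp) (by simp [Instr.Unit]) (by simp [Instr.Above]) ?_)
  intro s4 hs4 hf4
  have hr4 := hr3.congr fun r h => hf4 r (by omega)
  have e12 : s4.nat 12 = m * (d * d) + d * d * (2 * (d * d) + 1) + d * d := by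
    rw [← hs4]; simp [Instr.run, Store.setNat, NatOp.eval, hr3.r3, hr3.r4, hr3.r5]
  have hc4 : s4.cpx = s3.cpx := by
    rw [← hs4]; simp [Instr.run, Store.setNat]
  have e11 : s4.nat 11 = 1 := by
    rw [hf4 _ (by norm_num), hf3 _ (by norm_num), hf2 _ (by norm_num), h11]
  refine (run_rootLoop hr4 ?_ (hp.monic _ le_rfl) (hp.natDegree _ le_rfl) (fun i hi => ?_)
    e11).mono le_rfl ?_
  · rw [hr4.r6, e12, add_mul]; omega
  · rw [e12, hc4, hrow.2 i hi]
  rintro s5 ⟨M, hM, hL⟩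
  refine Run.block hl hu ⟨_, hf s5, fun θ hθ => ?_⟩
  obtain ⟨h0, heig⟩ := hp.last
  rw [hL, ← G.convergesAlong_iff M (hM ▸ h0) (fun μ hμ hμ0 => heig μ ?_ hμ0) hθ]
  rw [hM, ← Polynomial.dvd_iff_isRoot]
  exact Multiset.dvd_prod (Multiset.mem_map_of_mem _ hμ)

end Main

end QMC

theorem mainTheorem2 :
    (∃ (P : QMC.Prog) (C : ℕ),
      ∀ (d m : ℕ) (G : QMC.Chain d) (K : Fin m → Matrix (Fin d) (Fin d) ℂ),
        m ≤ d ^ 2 → QMC.IsKraus G.superOp K →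
        ∀ s : QMC.Store, s.HoldsInput K G.init →
          ∃ (s' : QMC.Store) (t : ℕ), QMC.Exec P s s' t ∧ t ≤ C * d ^ 8 ∧
            (s'.nat 0 = 0 ∨ s'.nat 0 = 1) ∧
            (s'.nat 0 = 1 ↔ G.PeriodicallyStable)) ∧
    (∃ (P : QMC.Prog) (C : ℕ),
      ∀ (d m : ℕ) (G : QMC.Chain d) (K : Fin m → Matrix (Fin d) (Fin d) ℂ),
        m ≤ d ^ 2 → QMC.IsKraus G.superOp K → G.PeriodicallyStable →
        ∀ s : QMC.Store, s.HoldsInput K G.init →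
          ∃ (s' : QMC.Store) (t : ℕ), QMC.Exec P s s' t ∧ t ≤ C * d ^ 8 ∧
            s'.nat 0 = G.period) := by
  -- With truncated subtraction, 1 - (1 - L) is 1 for L > 0 and 0 for L = 0. The second program just
  -- copies L.
  refine ⟨⟨.seq QMC.periodProg (QMC.block [.natConst 2 1, .natOp .minus 12 2 11,
    .natOp .minus 0 2 12]), 200, fun d m G K hm hK s hs => ?_⟩,
    ⟨.seq QMC.periodProg (QMC.block [.natConst 2 0, .natOp .plus 0 11 2]), 200,
      fun d m G K hm hK hG s hs => ?_⟩⟩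
  · obtain ⟨s', t, he, ht, L, h0, hL⟩ := QMC.run_periodProg G hm hK hs
      (l := [.natConst 2 1, .natOp .minus 12 2 11, .natOp .minus 0 2 12]) (by simp)
      (by simp [QMC.Instr.Unit]) (f := fun L => 1 - (1 - L))
      (fun s => by simp [QMC.Instr.run, QMC.Store.setNat, QMC.NatOp.eval])
    refine ⟨s', t, he, ht, by omega, ?_⟩
    rw [QMC.Chain.periodicallyStable_iff_ne_zero hL]
    omega
  · obtain ⟨s', t, he, ht, L, h0, hL⟩ := QMC.run_periodProg G hm hK hs
      (l := [.natConst 2 0, .natOp .plus 0 11 2]) (by simp) (by simp [QMC.Instr.Unit]) (f := id)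
      (fun s => by simp [QMC.Instr.run, QMC.Store.setNat, QMC.NatOp.eval])
    exact ⟨s', t, he, ht, h0.trans (QMC.Chain.period_eq hL hG).symm⟩
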